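/- Let $n\ge 0$ and let $\operatorname{Sym}_n^+$ be the manifold of real symmetric positive definite (SPD) $n\times n$ matrices, an open subset of the space $\operatorname{Sym}_n$ of symmetric matrices, equipped with one of the following Riemannian metrics $g\in\{le,lc,ai\}$, where $\mathbf P\in\operatorname{Sym}_n^+$, $\mathbf W,\mathbf V\in\operatorname{Sym}_n$, and $\langle\cdot,\cdot\rangle_F$ is the Frobenius inner product: - Log-Euclidean ($le$): $\langle \mathbf W,\mathbf V\rangle_{\mathbf P}=\langle D\log_{\mathbf P}(\mathbf W),D\log_{\mathbf P}(\mathbf V)\rangle_F$, where $\log$ is the matrix logarithm and $D\log_{\mathbf P}(\mathbf W)$ its directional derivative at $\mathbf P$ along $\mathbf W$; - Log-Cholesky ($lc$): $\langle \mathbf W,\mathbf V\rangle_{\mathbf P}=\langle\lfloor \mathbf X\rfloor,\lfloor \mathbf Y\rfloor\rangle_F+\langle \mathbb D(\mathbf L)^{-1}\mathbb D(\mathbf X),\mathbb D(\mathbf L)^{-1}\mathbb D(\mathbf Y)\rangle_F$, where $\mathbf L$ is the Cholesky factor of $\mathbf P$ (lower triangular, positive diagonal, $\mathbf L\mathbf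 L^T=\mathbf P$), $\mathbf X=\mathbf L(\mathbf L^{-1}\mathbf W\mathbf L^{-T})_{1/2}$, $\mathbf Y=\mathbf L(\mathbf L^{-1}\mathbf V\mathbf L^{-T})_{1/2}$, $\lfloor\cdot\rfloor$ is the strictly lower triangular part, $\mathbb D(\cdot)$ the diagonal part, and $(\cdot)_{1/2}$ the lower triangular part with the diagonal halved; - Affine-Invariant ($ai$): $\langle \mathbf W,\mathbf V\rangle_{\mathbf P}=\operatorname{tr}(\mathbf P^{-1}\mathbf W\mathbf P^{-1}\mathbf V)$. Let $\operatorname{Exp}$, $\operatorname{Log}$ and $\mathcal T_{\mathbf P\to\mathbf Q}$ be the Riemannian exponential map, the Riemannian logarithm, and parallel transport along the geodesic connecting $\mathbf P$ and $\mathbf Q$, for the Levi-Civita connection of the chosen metric, and let $\mathbf I$ be the identity matrix. Put $$\mathbf P\oplus_g\mathbf Q=\operatorname{Exp}_{\mathbf P}\big(\mathcal T_{\mathbf I\to\mathbf P}(\operatorname{Log}_{\mathbf I}(\mathbf Q))\big),\qquad \|\mathbf P\|=\sqrt{\langle\operatorname{Log}_{\mathbf I}(\mathbf P),\operatorname{Log}_{\mathbf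 I}(\mathbf P)\rangle_{\mathbf I}} .$$ Then every $\mathbf P\in\operatorname{Sym}_n^+$ has a unique left inverse $\ominus_g\mathbf P\in\operatorname{Sym}_n^+$, i.e. $\ominus_g\mathbf P\oplus_g\mathbf P=\mathbf I$, and the SPD inverse map $\mathbf P\mapsto\ominus_g\mathbf P$ preserves the SPD gyrodistance $d(\mathbf P,\mathbf Q)=\|\ominus_g\mathbf P\oplus_g\mathbf Q\|$: for all $\mathbf P,\mathbf Q\in\operatorname{Sym}_n^+$, $$d(\ominus_g\mathbf P,\ominus_g\mathbf Q)=d(\mathbf P,\mathbf Q).$$ -/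

import Mathlib

noncomputable section

namespace SPDGyro

open Matrix

/-- Real `n × n` matrices. Tangent vectors of the SPD manifold are the symmetric ones. -/
abbrev Mat (n : ℕ) : Type := Matrix (Fin n) (Fin n) ℝ

/-- The manifold of symmetric positive definite matrices, an open subset of the vector space of
symmetric matrices. -/
abbrev SPD (n : ℕ) : Type := {P : Mat n // P.PosDef}

/-- The identity matrix as a point of the SPD manifold. -/
def SPD.id (n : ℕ) : SPD n := ⟨1, Matrix.PosDef.one⟩

instance (n : ℕ) : Nonempty (SPD n) := ⟨SPD.id n⟩

/-- The Frobenius inner product of matrices. -/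
def frob {n : ℕ} (A B : Mat n) : ℝ := (Aᵀ * B).trace

/-! ### Riemannian geometry on the SPD manifold, in its global chart -/

/-- A Riemannian metric in the global chart: `g P W V` is the inner product at `P` of the tangent
vectors `W` and `V`. Only values at SPD `P` and symmetric `W`, `V` matter. -/
abbrev RMetric (n : ℕ) : Type := Mat n → Mat n → Mat n → ℝ

/-- The directional derivative at `P`, in direction `Z`, of the coefficient `P ↦ g P W V`. -/
def dMetric {n : ℕ} (g : RMetric n) (P Z W V : Mat n) : ℝ :=
  deriv (fun t : ℝ => g (P + t • Z) W V) 0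

/-- The Christoffel symbols of the first kind of the Levi-Civita connection: in the global chart,
`⟨∇_W V, Z⟩_P = christoffel g P W V Z` for constant vector fields `W`, `V`, `Z`. -/
def christoffel {n : ℕ} (g : RMetric n) (P W V Z : Mat n) : ℝ :=
  (dMetric g P W V Z + dMetric g P V W Z - dMetric g P Z W V) / 2

/-- A curve in the SPD manifold, seen as a curve of matrices. -/
def curve {n : ℕ} (γ : ℝ → SPD n) : ℝ → Mat n := fun t => (γ t).1

/-- The vector field `V` is parallel along the curve `γ` for the Levi-Civita connection: its
covariant derivative along `γ` (tested against all tangent vectors `Z`) vanishes. -/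
def IsParallelAlong {n : ℕ} (g : RMetric n) (γ : ℝ → SPD n) (V : ℝ → Mat n) : Prop :=
  Differentiable ℝ (curve γ) ∧ Differentiable ℝ V ∧ (∀ t, (V t).IsSymm) ∧
    ∀ t, ∀ Z : Mat n, Z.IsSymm →
      g (γ t).1 (deriv V t) Z + christoffel g (γ t).1 (deriv (curve γ) t) (V t) Z = 0

/-- Geodesics: curves whose velocity field is parallel. -/
def IsGeodesic {n : ℕ} (g : RMetric n) (γ : ℝ → SPD n) : Prop :=
  IsParallelAlong g γ (deriv (curve γ))

/-- The Riemannian exponential map: `riemExp g P W = γ 1` for the geodesic `γ` with `γ 0 = P` and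
initial velocity `W`. -/
def riemExp {n : ℕ} (g : RMetric n) (P : SPD n) (W : Mat n) : SPD n :=
  Classical.epsilon fun R =>
    ∃ γ : ℝ → SPD n, IsGeodesic g γ ∧ γ 0 = P ∧ deriv (curve γ) 0 = W ∧ γ 1 = R

/-- The Riemannian logarithm: the tangent vector at `P` that the exponential map at `P` sends
to `Q`. -/
def riemLog {n : ℕ} (g : RMetric n) (P Q : SPD n) : Mat n :=
  Classical.epsilon fun W => W.IsSymm ∧ riemExp g P W = Q

/-- Parallel transport of the tangent vector `W` from `P` to `Q` along the geodesic connecting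
`P` and `Q`. -/
def transport {n : ℕ} (g : RMetric n) (P Q : SPD n) (W : Mat n) : Mat n :=
  Classical.epsilon fun W' =>
    ∃ (γ : ℝ → SPD n) (V : ℝ → Mat n), IsGeodesic g γ ∧ γ 0 = P ∧ γ 1 = Q ∧
      IsParallelAlong g γ V ∧ V 0 = W ∧ V 1 = W'

/-! ### The Log-Euclidean, Log-Cholesky and Affine-Invariant metrics -/

/-- The usual logarithm of an SPD matrix. -/
def matLog {n : ℕ} (P : Mat n) : Mat n := cfc Real.log P

/-- The directional derivative of the matrix logarithm at `P` along `W`. -/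
def dLog {n : ℕ} (P W : Mat n) : Mat n := deriv (fun t : ℝ => matLog (P + t • W)) 0

/-- The Log-Euclidean metric. -/
def metricLE (n : ℕ) : RMetric n := fun P W V => frob (dLog P W) (dLog P V)

/-- The strictly lower triangular part of a matrix. -/
def strictLower {n : ℕ} (A : Mat n) : Mat n := Matrix.of fun i j => if j < i then A i j else 0

/-- The diagonal part of a matrix. -/
def diagPart {n : ℕ} (A : Mat n) : Mat n := Matrix.diagonal fun i => A i i

/-- The lower triangular part of a matrix with the diagonal entries halved. -/
def lowerHalf {n : ℕ} (A : Mat n) : Mat n := strictLower A + (1 / 2 : ℝ) • diagPart A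

/-- `L` is a Cholesky factor of `P`: it is lower triangular, has positive diagonal entries, and
satisfies `P = L Lᵀ`. -/
def IsCholesky {n : ℕ} (P L : Mat n) : Prop :=
  (∀ i j, i < j → L i j = 0) ∧ (∀ i, 0 < L i i) ∧ L * Lᵀ = P

/-- The Cholesky factor of an SPD matrix. -/
def chol {n : ℕ} (P : Mat n) : Mat n := Classical.epsilon (IsCholesky P)

/-- The metric on the manifold of lower triangular matrices with positive diagonal entries from
which the Log-Cholesky metric is pulled back. -/
def metricCholesky {n : ℕ} (L X Y : Mat n) : ℝ :=
  frob (strictLower X) (strictLower Y) +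
    frob ((diagPart L)⁻¹ * diagPart X) ((diagPart L)⁻¹ * diagPart Y)

/-- The differential of the Cholesky map, in terms of the Cholesky factor `L` of the base point:
`W ↦ L (L⁻¹ W L⁻ᵀ)_{1/2}`. -/
def dChol {n : ℕ} (L W : Mat n) : Mat n := L * lowerHalf (L⁻¹ * W * (L⁻¹)ᵀ)

/-- The Log-Cholesky metric. -/
def metricLC (n : ℕ) : RMetric n := fun P W V =>
  metricCholesky (chol P) (dChol (chol P) W) (dChol (chol P) V)

/-- The Affine-Invariant metric. -/
def metricAI (n : ℕ) : RMetric n := fun P W V => (P⁻¹ * W * P⁻¹ * V).trace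

/-- The three geometries `le`, `lc`, `ai` considered on the SPD manifold. -/
inductive Geometry : Type
  | le
  | lc
  | ai

/-- The Riemannian metric of each of the three geometries. -/
def Geometry.metric (k : Geometry) (n : ℕ) : RMetric n :=
  match k with
  | .le => metricLE n
  | .lc => metricLC n
  | .ai => metricAI n

/-! ### Gyrovector operations, gyrodistance and gyroisometries -/

/-- `P ⊕ Q = Exp_P (T_{I → P} (Log_I Q))`. -/
def gyroAdd {n : ℕ} (g : RMetric n) (P Q : SPD n) : SPD n :=
  riemExp g P (transport g (SPD.id n) P (riemLog g (SPD.id n) Q))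

/-- `⊖ P`: the left inverse of `P`, characterised by `⊖ P ⊕ P = I`. This is the SPD inverse map. -/
def gyroNeg {n : ℕ} (g : RMetric n) (P : SPD n) : SPD n :=
  Classical.epsilon fun R => gyroAdd g R P = SPD.id n

/-- The SPD inner product `⟨P, Q⟩ = ⟨Log_I P, Log_I Q⟩_I`. -/
def spdInner {n : ℕ} (g : RMetric n) (P Q : SPD n) : ℝ :=
  g (SPD.id n).1 (riemLog g (SPD.id n) P) (riemLog g (SPD.id n) Q)

/-- The SPD norm induced by the SPD inner product. -/
def spdNorm {n : ℕ} (g : RMetric n) (P : SPD n) : ℝ := Real.sqrt (spdInner g P P)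

/-- The SPD gyrodistance `d(P, Q) = ‖⊖ P ⊕ Q‖`. -/
def gyroDist {n : ℕ} (g : RMetric n) (P Q : SPD n) : ℝ := spdNorm g (gyroAdd g (gyroNeg g P) Q)

/-- SPD gyroisometries: maps preserving the SPD gyrodistance. -/
def IsGyroisometry {n : ℕ} (g : RMetric n) (ω : SPD n → SPD n) : Prop :=
  ∀ P Q : SPD n, gyroDist g (ω P) (ω Q) = gyroDist g P Q

end SPDGyro

end

noncomputable section

namespace SPDGyro

open Matrix NormedSpace Filter Topology
open scoped Matrix.Norms.L2Operator MatrixOrder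

/-! ### Symmetric and positive definite matrices, exponential and logarithm. -/

variable {n : ℕ}

/-! For `le` and `lc` the metric is flat: a global chart `Φ` carries the SPD manifold onto a linear
space `F` and pulls the constant Frobenius metric back to `g`. For `le`, `Φ` is the matrix logarithm
and `F` the symmetric matrices; for `lc`, `Φ` is the Cholesky factor with the logarithm applied to
its diagonal and `F` the lower triangular matrices. In such a chart geodesics are straight lines and
parallel fields are constant, and `Φ I = 0`, so `Φ (P ⊕ Q) = Φ P + Φ Q` (`IsFlatChart.map_gyroAdd`).
The left inverse has coordinate `-Φ P`, the gyrodistance is the Frobenius norm of `Φ Q - Φ P`, and a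
change of sign preserves it. Both charts are extended to all matrices, so that ordinary Fréchet
derivatives on `Mat n` apply.

The `ai` metric is handled by closed formulas. Geodesics are `√P exp (tS) √P`, and transport from
`I` to `P` is `X ↦ √P X √P`, hence `P ⊕ Q = √P Q √P` (`gyroAdd_metricAI`) and `⊖ P = P⁻¹`. The two
distances to compare are the norms of `√P Q⁻¹ √P` and of its inverse, whose logarithms differ only
by a sign.

As `Exp`, `Log` and transport are choices by `epsilon`, each computation needs existence and
uniqueness. Existence comes from explicit curves. Uniqueness comes from conserved quantities rather
than from a general theorem on differential equations. -/

theorem isSelfAdjoint_of_isSymm {X : Mat n} (hX : X.IsSymm) : IsSelfAdjoint X := by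
  rw [IsSelfAdjoint, star_eq_conjTranspose, conjTranspose_eq_transpose_of_trivial, hX.eq]

theorem isSymm_of_posDef {P : Mat n} (hP : P.PosDef) : P.IsSymm := by
  have := hP.isHermitian.eq
  rwa [conjTranspose_eq_transpose_of_trivial] at this

theorem matLog_exp {X : Mat n} (hX : X.IsSymm) : matLog (exp X) = X :=
  CFC.log_exp (A := Mat n) X (isSelfAdjoint_of_isSymm hX)

theorem exp_matLog {P : Mat n} (hP : P.PosDef) : exp (matLog P) = P :=
  CFC.exp_log (A := Mat n) P hP.isStrictlyPositive

theorem isSymm_matLog (P : Mat n) : (matLog P).IsSymm := by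
  have : IsSelfAdjoint (matLog P) := cfc_predicate _ P
  rwa [IsSelfAdjoint, star_eq_conjTranspose, conjTranspose_eq_transpose_of_trivial] at this

theorem exp_mul_exp_neg (X : Mat n) : exp X * exp (-X) = 1 := by
  rw [← Matrix.exp_add_of_commute _ _ (Commute.refl X).neg_right, add_neg_cancel, exp_zero]

theorem exp_neg_mul_exp (X : Mat n) : exp (-X) * exp X = 1 := by
  simpa using exp_mul_exp_neg (-X)

theorem exp_half_mul_exp_half (X : Mat n) :
    exp ((1 / 2 : ℝ) • X) * exp ((1 / 2 : ℝ) • X) = exp X := by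
  rw [← Matrix.exp_add_of_commute _ _ rfl, ← add_smul]
  norm_num

theorem posDef_mul_mul_transpose {P : Mat n} (hP : P.PosDef) {L : Mat n} (hL : IsUnit L) :
    (L * P * Lᵀ).PosDef := by
  rw [← conjTranspose_eq_transpose_of_trivial]
  exact (IsUnit.posDef_star_right_conjugate_iff hL).2 hP

theorem posDef_exp {X : Mat n} (hX : X.IsSymm) : (exp X).PosDef := by
  have h := posDef_mul_mul_transpose PosDef.one (Matrix.isUnit_exp ((1 / 2 : ℝ) • X))
  rwa [mul_one, (hX.smul _).exp.eq, exp_half_mul_exp_half] at h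

/-- After diagonalising `S` the eigenvalues are `1 + t λᵢ`, finitely many and positive for small
`t`. -/
theorem eventually_posDef_one_add_smul {S : Mat n} (hS : S.IsSymm) :
    ∀ᶠ t : ℝ in 𝓝 0, (1 + t • S).PosDef := by
  have hH : S.IsHermitian := isSelfAdjoint_of_isSymm hS
  have hev : ∀ᶠ t : ℝ in 𝓝 0, ∀ i, 0 < 1 + t * hH.eigenvalues i := by
    refine eventually_all.2 fun i => ?_
    have : ContinuousAt (fun t : ℝ => 1 + t * hH.eigenvalues i) 0 := by fun_prop
    exact this.eventually (lt_mem_nhds (by simp))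
  filter_upwards [hev] with t ht
  have h : 1 + t • S = Unitary.conjStarAlgAut ℝ (Mat n) hH.eigenvectorUnitary
      (diagonal fun i => 1 + t * hH.eigenvalues i) := by
    have e : (diagonal fun i => 1 + t * hH.eigenvalues i : Mat n) =
        1 + t • diagonal (RCLike.ofReal ∘ hH.eigenvalues) := by
      rw [← diagonal_one, ← diagonal_smul, diagonal_add]
      rfl
    rw [e, map_add, map_one, map_smul, ← hH.spectral_theorem]
  rw [h, Unitary.conjStarAlgAut_apply]
  exact (IsUnit.posDef_star_right_conjugate_iff (Unitary.toUnits hH.eigenvectorUnitary).isUnit).2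
    (PosDef.diagonal ht)

/-- Conjugation by the square root of `P` reduces this to `P = 1`. It allows identities known only
on SPD matrices to be differentiated in symmetric directions. -/
theorem eventually_posDef_add_smul {P Z : Mat n} (hP : P.PosDef) (hZ : Z.IsSymm) :
    ∀ᶠ t : ℝ in 𝓝 0, (P + t • Z).PosDef := by
  set R : Mat n := exp ((1 / 2 : ℝ) • matLog P) with hR
  set R' : Mat n := exp (-((1 / 2 : ℝ) • matLog P)) with hR'
  have hl := (isSymm_matLog P).smul (1 / 2 : ℝ)
  have h1 : R * R' = 1 := exp_mul_exp_neg _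
  have h2 : R' * R = 1 := exp_neg_mul_exp _
  have h3 : R * R = P := by rw [hR, exp_half_mul_exp_half, exp_matLog hP]
  have h4 : Rᵀ = R := hl.exp.eq
  have h5 : R'ᵀ = R' := hl.neg.exp.eq
  have hS : (R' * Z * R').IsSymm := by
    rw [IsSymm, transpose_mul, transpose_mul, h5, hZ.eq, Matrix.mul_assoc]
  filter_upwards [eventually_posDef_one_add_smul hS] with t ht
  convert posDef_mul_mul_transpose ht (Matrix.isUnit_exp ((1 / 2 : ℝ) • matLog P)) using 1
  rw [← hR, h4, mul_add, add_mul, mul_one, h3, Matrix.mul_smul, Matrix.smul_mul]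
  congr 2
  calc Z = (R * R') * Z * (R' * R) := by rw [h1, h2, one_mul, mul_one]
    _ = _ := by noncomm_ring

/-! ### Calculus for matrix-valued curves and maps. -/

theorem contDiff_exp : ContDiff ℝ ⊤ (fun X : Mat n => exp X) :=
  contDiff_iff_contDiffAt.2 fun x =>
    (NormedSpace.exp_analytic (𝕂 := ℝ) x : AnalyticAt ℝ (exp : Mat n → Mat n) x).contDiffAt

/-- Transposition as a continuous linear map. -/
def transposeCLM (n : ℕ) : Mat n →L[ℝ] Mat n :=
  LinearMap.toContinuousLinearMap (transposeLinearEquiv (Fin n) (Fin n) ℝ ℝ).toLinearMap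

@[simp] theorem transposeCLM_apply (A : Mat n) : transposeCLM n A = Aᵀ := rfl

theorem HasDerivAt.matTranspose {f : ℝ → Mat n} {f' : Mat n} {t : ℝ} (h : HasDerivAt f f' t) :
    HasDerivAt (fun s => (f s)ᵀ) f'ᵀ t :=
  (transposeCLM n).hasFDerivAt.comp_hasDerivAt t h

theorem isSymm_of_hasDerivAt {f : ℝ → Mat n} {f' : Mat n} {t : ℝ} (h : HasDerivAt f f' t)
    (hf : ∀ s, (f s).IsSymm) : f'.IsSymm := by
  have h1 := HasDerivAt.matTranspose h
  simp only [fun s => (hf s).eq] at h1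
  exact h1.unique h

/-- A left inverse of a smooth map is smooth at the image of a point where the derivative is
injective. -/
theorem contDiffAt_of_leftInverse {E : Type*} [NormedAddCommGroup E] [NormedSpace ℝ E]
    [FiniteDimensional ℝ E] {f g : E → E} {m : WithTop ℕ∞} (hm : m ≠ 0) (hf : ContDiff ℝ m f)
    (hgf : ∀ x, g (f x) = x) {a : E}
    (ha : ∀ v, fderiv ℝ f a v = 0 → v = 0) : ContDiffAt ℝ m g (f a) := by
  have hinj : Function.Injective (fderiv ℝ f a).toLinearMap :=
    (injective_iff_map_eq_zero _).2 ha
  -- In finite dimension an injective derivative is invertible, so the inverse function theorem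
  -- applies; the local inverse must then agree with `g` near `f a`.
  let e : E ≃L[ℝ] E := (LinearEquiv.ofInjectiveEndo _ hinj).toContinuousLinearEquiv
  have hfe : HasFDerivAt f (e : E →L[ℝ] E) a := by
    convert (hf.differentiable hm a).hasFDerivAt using 1
    ext v
    rfl
  have : CompleteSpace E := FiniteDimensional.complete ℝ E
  have hs : HasStrictFDerivAt f (e : E →L[ℝ] E) a := hf.contDiffAt.hasStrictFDerivAt' hfe hm
  exact (hf.contDiffAt.to_localInverse hfe hm).congr_of_eventuallyEq
    (hs.localInverse_unique (Eventually.of_forall hgf))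
theorem epsilon_eq {α : Type*} [Nonempty α] {p : α → Prop} {a : α} (ha : p a)
    (hu : ∀ b, p b → b = a) : Classical.epsilon p = a :=
  hu _ (Classical.epsilon_spec ⟨a, ha⟩)

/-- The trace as a continuous linear map. -/
def traceCLM (n : ℕ) : Mat n →L[ℝ] ℝ :=
  LinearMap.toContinuousLinearMap (traceLinearMap (Fin n) ℝ ℝ)

theorem HasDerivAt.matTrace {f : ℝ → Mat n} {f' : Mat n} {t : ℝ} (h : HasDerivAt f f' t) :
    HasDerivAt (fun s => (f s).trace) f'.trace t :=
  (traceCLM n).hasFDerivAt.comp_hasDerivAt t h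

theorem HasDerivAt.frob {A B : ℝ → Mat n} {A' B' : Mat n} {t : ℝ} (hA : HasDerivAt A A' t)
    (hB : HasDerivAt B B' t) :
    HasDerivAt (fun s => frob (A s) (B s)) (frob A' (B t) + frob (A t) B') t := by
  have h := HasDerivAt.matTrace ((HasDerivAt.matTranspose hA).fun_mul hB)
  rwa [trace_add] at h

theorem frob_add_left (A B C : Mat n) : frob (A + B) C = frob A C + frob B C := by
  simp [frob, add_mul]

theorem frob_comm (A B : Mat n) : frob A B = frob B A := by
  rw [frob, frob, ← trace_transpose, transpose_mul, transpose_transpose]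

theorem frob_neg_neg (A B : Mat n) : frob (-A) (-B) = frob A B := by
  simp [frob]

theorem frob_self_eq_zero {A : Mat n} (h : frob A A = 0) : A = 0 := by
  rw [frob, ← conjTranspose_eq_transpose_of_trivial] at h
  exact trace_conjTranspose_mul_self_eq_zero_iff.1 h

/-- The difference quotients lie in `F`, which is closed. -/
theorem mem_of_hasDerivAt {E : Type*} [NormedAddCommGroup E] [NormedSpace ℝ E]
    [FiniteDimensional ℝ E] (F : Submodule ℝ E) {f : ℝ → E} {f' : E} {t : ℝ}
    (h : HasDerivAt f f' t) (hf : ∀ᶠ s in 𝓝 t, f s ∈ F) : f' ∈ F := by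
  refine F.closed_of_finiteDimensional.mem_of_tendsto (hasDerivAt_iff_tendsto_slope.1 h) ?_
  filter_upwards [hf.filter_mono nhdsWithin_le_nhds] with s hs
  exact F.smul_mem _ (F.sub_mem hs hf.self_of_nhds)

theorem hasDerivAt_fderiv_apply {E : Type*} [NormedAddCommGroup E] [NormedSpace ℝ E]
    {f : E → E} {c v : ℝ → E} {c' v' : E} {t : ℝ} (hf : ContDiffAt ℝ 2 f (c t))
    (hc : HasDerivAt c c' t) (hv : HasDerivAt v v' t) :
    HasDerivAt (fun s => fderiv ℝ f (c s) (v s))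
      (fderiv ℝ (fderiv ℝ f) (c t) c' (v t) + fderiv ℝ f (c t) v') t := by
  have h1 : HasFDerivAt (fderiv ℝ f) (fderiv ℝ (fderiv ℝ f) (c t)) (c t) :=
    ((hf.fderiv_right (m := 1) (by norm_num)).differentiableAt one_ne_zero).hasFDerivAt
  exact (h1.comp_hasDerivAt t hc).clm_apply hv

theorem hasDerivAt_add_smul (P W : Mat n) (t : ℝ) : HasDerivAt (fun s : ℝ => P + s • W) W t := by
  simpa using ((hasDerivAt_id t).smul_const W).const_add P

theorem HasFDerivAt.hasDerivAt_add_smul {f : Mat n → Mat n} {f' : Mat n →L[ℝ] Mat n} {P : Mat n}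
    (hf : HasFDerivAt f f' P) (W : Mat n) : HasDerivAt (fun t : ℝ => f (P + t • W)) (f' W) 0 :=
  HasFDerivAt.comp_hasDerivAt 0 (by simpa using hf) (SPDGyro.hasDerivAt_add_smul P W 0)

theorem add_smul_mem {F : Submodule ℝ (Mat n)} {x Y : Mat n} (hx : x ∈ F) (hY : Y ∈ F) (t : ℝ) : x + t • Y ∈ F :=
  F.add_mem hx (F.smul_mem t hY)

/-! ### Flat charts: geodesics, transport and gyroaddition. -/

/-- A global chart of the manifold of SPD matrices, with values in a linear space `F`, in which
the metric `g` is the constant Frobenius metric. -/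
structure IsFlatChart (g : RMetric n) (Φ Ψ : Mat n → Mat n) (F : Submodule ℝ (Mat n)) : Prop where
  contDiff_symm : ContDiff ℝ 2 Ψ
  contDiffAt : ∀ P : Mat n, P.PosDef → ContDiffAt ℝ 2 Φ P
  mem : ∀ P : Mat n, P.PosDef → Φ P ∈ F
  posDef : ∀ x ∈ F, (Ψ x).PosDef
  right_inv : ∀ x ∈ F, Φ (Ψ x) = x
  left_inv : ∀ P : Mat n, P.PosDef → Ψ (Φ P) = P
  metric_eq : ∀ P W V : Mat n, P.PosDef → W.IsSymm → V.IsSymm →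
    g P W V = frob (fderiv ℝ Φ P W) (fderiv ℝ Φ P V)
  map_one : Φ 1 = 0

namespace IsFlatChart

variable {g : RMetric n} {Φ Ψ : Mat n → Mat n} {F : Submodule ℝ (Mat n)}
  (h : IsFlatChart g Φ Ψ F)
include h

theorem hasFDerivAt {P : Mat n} (hP : P.PosDef) : HasFDerivAt Φ (fderiv ℝ Φ P) P :=
  ((h.contDiffAt P hP).differentiableAt two_ne_zero).hasFDerivAt

theorem hasFDerivAt_symm (x : Mat n) : HasFDerivAt Ψ (fderiv ℝ Ψ x) x :=
  (h.contDiff_symm.differentiable two_ne_zero x).hasFDerivAt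

theorem hasDerivAt_line {P W : Mat n} (hP : P.PosDef) :
    HasDerivAt (fun t : ℝ => Φ (P + t • W)) (fderiv ℝ Φ P W) 0 :=
  HasFDerivAt.hasDerivAt_add_smul (h.hasFDerivAt hP) W

theorem fderiv_mem {P W : Mat n} (hP : P.PosDef) (hW : W.IsSymm) : fderiv ℝ Φ P W ∈ F :=
  mem_of_hasDerivAt F (h.hasDerivAt_line hP)
    ((eventually_posDef_add_smul hP hW).mono fun _ ht => h.mem _ ht)

/-- The identity `Ψ ∘ Φ = id` holds only on SPD matrices, hence is differentiated along a symmetric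
direction. -/
theorem fderiv_symm_fderiv {P W : Mat n} (hP : P.PosDef) (hW : W.IsSymm) :
    fderiv ℝ Ψ (Φ P) (fderiv ℝ Φ P W) = W := by
  have h1 : HasDerivAt (fun t : ℝ => Ψ (Φ (P + t • W)))
      (fderiv ℝ Ψ (Φ P) (fderiv ℝ Φ P W)) 0 :=
    HasFDerivAt.comp_hasDerivAt (0 : ℝ) (by simpa using h.hasFDerivAt_symm (Φ P))
      (h.hasDerivAt_line hP)
  refine (h1.congr_of_eventuallyEq ?_).unique (hasDerivAt_add_smul P W 0)
  filter_upwards [eventually_posDef_add_smul hP hW] with t ht using (h.left_inv _ ht).symm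

theorem hasDerivAt_symm_line (x Y : Mat n) (t : ℝ) :
    HasDerivAt (fun s : ℝ => Ψ (x + s • Y)) (fderiv ℝ Ψ (x + t • Y) Y) t :=
  HasFDerivAt.comp_hasDerivAt t (h.hasFDerivAt_symm _) (hasDerivAt_add_smul x Y t)

theorem isSymm_fderiv_symm {x Y : Mat n} (hx : x ∈ F) (hY : Y ∈ F) :
    (fderiv ℝ Ψ x Y).IsSymm := by
  have h1 := h.hasDerivAt_symm_line x Y 0
  rw [zero_smul, add_zero] at h1
  exact isSymm_of_hasDerivAt h1 fun s => isSymm_of_posDef (h.posDef _ (add_smul_mem hx hY s))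

theorem fderiv_fderiv_symm {x Y : Mat n} (hx : x ∈ F) (hY : Y ∈ F) :
    fderiv ℝ Φ (Ψ x) (fderiv ℝ Ψ x Y) = Y := by
  have h0 := h.hasDerivAt_symm_line x Y 0
  rw [zero_smul, add_zero] at h0
  have h1 : HasDerivAt (fun t : ℝ => Φ (Ψ (x + t • Y))) (fderiv ℝ Φ (Ψ x) (fderiv ℝ Ψ x Y)) 0 :=
    HasFDerivAt.comp_hasDerivAt (0 : ℝ) (by simpa using h.hasFDerivAt (h.posDef x hx)) h0
  simp only [fun t => h.right_inv _ (add_smul_mem hx hY t)] at h1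
  exact h1.unique (hasDerivAt_add_smul x Y 0)

/-- Testing against symmetric `Z` thus amounts to testing against all of `F`, where the Frobenius
product is definite. -/
theorem exists_isSymm_fderiv_eq {P Y : Mat n} (hP : P.PosDef) (hY : Y ∈ F) :
    ∃ W : Mat n, W.IsSymm ∧ fderiv ℝ Φ P W = Y := by
  refine ⟨fderiv ℝ Ψ (Φ P) Y, h.isSymm_fderiv_symm (h.mem P hP) hY, ?_⟩
  have := h.fderiv_fderiv_symm (h.mem P hP) hY
  rwa [h.left_inv P hP] at this

theorem fderiv_injOn {P W V : Mat n} (hP : P.PosDef) (hW : W.IsSymm) (hV : V.IsSymm)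
    (hWV : fderiv ℝ Φ P W = fderiv ℝ Φ P V) : W = V := by
  rw [← h.fderiv_symm_fderiv hP hW, hWV, h.fderiv_symm_fderiv hP hV]

theorem injOn {P Q : SPD n} (hPQ : Φ P.1 = Φ Q.1) : P = Q :=
  Subtype.ext (by rw [← h.left_inv _ P.2, hPQ, h.left_inv _ Q.2])

theorem dMetric_eq {P Z W V : Mat n} (hP : P.PosDef) (hZ : Z.IsSymm) (hW : W.IsSymm)
    (hV : V.IsSymm) :
    dMetric g P Z W V = frob (fderiv ℝ (fderiv ℝ Φ) P Z W) (fderiv ℝ Φ P V) +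
      frob (fderiv ℝ Φ P W) (fderiv ℝ (fderiv ℝ Φ) P Z V) := by
  have h1 : ∀ U : Mat n, HasDerivAt (fun t : ℝ => fderiv ℝ Φ (P + t • Z) U)
      (fderiv ℝ (fderiv ℝ Φ) P Z U) 0 := fun U => by
    have h2 := hasDerivAt_fderiv_apply (by simpa using h.contDiffAt P hP)
      (hasDerivAt_add_smul P Z 0) (hasDerivAt_const 0 U)
    simpa using h2
  have h3 := HasDerivAt.frob (h1 W) (h1 V)
  rw [zero_smul, add_zero] at h3
  refine (h3.congr_of_eventuallyEq ?_).deriv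
  filter_upwards [eventually_posDef_add_smul hP hZ] with t ht using h.metric_eq _ _ _ ht hW hV

/-- By the product rule the three derivatives of the metric give six terms; the symmetry of the
second derivative of `Φ` makes two coincide and the other four cancel. -/
theorem christoffel_eq {P W V Z : Mat n} (hP : P.PosDef) (hW : W.IsSymm) (hV : V.IsSymm)
    (hZ : Z.IsSymm) :
    christoffel g P W V Z = frob (fderiv ℝ (fderiv ℝ Φ) P W V) (fderiv ℝ Φ P Z) := by
  have hs : IsSymmSndFDerivAt ℝ Φ P := (h.contDiffAt P hP).isSymmSndFDerivAt (by simp)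
  rw [christoffel, h.dMetric_eq hP hW hV hZ, h.dMetric_eq hP hV hW hZ, h.dMetric_eq hP hZ hW hV,
    hs.eq V W, hs.eq Z W, hs.eq Z V, frob_comm (fderiv ℝ (fderiv ℝ Φ) P W Z)]
  ring

/-- The chain rule gives `d/dt DΦ(V) = D²Φ(γ', V) + DΦ(V')`, and the Frobenius product of this with
`DΦ(Z)` is the covariant derivative tested on `Z`. -/
theorem isParallelAlong_iff {γ : ℝ → SPD n} {V : ℝ → Mat n} :
    IsParallelAlong g γ V ↔ Differentiable ℝ (curve γ) ∧ Differentiable ℝ V ∧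
      (∀ t, (V t).IsSymm) ∧
        ∀ t, HasDerivAt (fun s => fderiv ℝ Φ (γ s).1 (V s)) 0 t := by
  refine and_congr_right fun hγ => and_congr_right fun hV => and_congr_right fun hs =>
    forall_congr' fun t => ?_
  have hd : HasDerivAt (fun s => fderiv ℝ Φ (γ s).1 (V s))
      (fderiv ℝ (fderiv ℝ Φ) (γ t).1 (deriv (curve γ) t) (V t) +
        fderiv ℝ Φ (γ t).1 (deriv V t)) t :=
    hasDerivAt_fderiv_apply (h.contDiffAt _ (γ t).2) (hγ t).hasDerivAt (hV t).hasDerivAt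
  have hγs : (deriv (curve γ) t).IsSymm :=
    isSymm_of_hasDerivAt (hγ t).hasDerivAt fun s => isSymm_of_posDef (γ s).2
  have hVs : (deriv V t).IsSymm := isSymm_of_hasDerivAt (hV t).hasDerivAt hs
  have key : ∀ Z : Mat n, Z.IsSymm →
      g (γ t).1 (deriv V t) Z + christoffel g (γ t).1 (deriv (curve γ) t) (V t) Z =
        frob (fderiv ℝ (fderiv ℝ Φ) (γ t).1 (deriv (curve γ) t) (V t) +
          fderiv ℝ Φ (γ t).1 (deriv V t)) (fderiv ℝ Φ (γ t).1 Z) := fun Z hZ => by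
    rw [h.metric_eq _ _ _ (γ t).2 hVs hZ, h.christoffel_eq (γ t).2 hγs (hs t) hZ, frob_add_left,
      add_comm]
  constructor
  · intro h0
    -- The derivative lies in `F`, so it equals `DΦ(Z)` for some symmetric `Z` and can be tested
    -- against itself.
    have hm := mem_of_hasDerivAt F hd
      (Eventually.of_forall fun s => h.fderiv_mem (γ s).2 (hs s))
    obtain ⟨Z, hZ, hZe⟩ := h.exists_isSymm_fderiv_eq (γ t).2 hm
    have h1 := h0 Z hZ
    rw [key Z hZ, hZe] at h1
    rwa [frob_self_eq_zero h1] at hd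
  · intro h0 Z hZ
    rw [key Z hZ, hd.unique h0]
    simp [frob]

theorem fderiv_eq_of_isParallelAlong {γ : ℝ → SPD n} {V : ℝ → Mat n}
    (hV : IsParallelAlong g γ V) (t s : ℝ) :
    fderiv ℝ Φ (γ t).1 (V t) = fderiv ℝ Φ (γ s).1 (V s) := by
  have h0 := (h.isParallelAlong_iff.1 hV).2.2.2
  exact is_const_of_deriv_eq_zero (fun t => (h0 t).differentiableAt) (fun t => (h0 t).deriv) t s

/-- The coordinate velocity of a geodesic is conserved. This is the uniqueness half of the
computation of `Exp`. -/
theorem map_geodesic {γ : ℝ → SPD n} (hγ : IsGeodesic g γ) (t : ℝ) :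
    Φ (γ t).1 = Φ (γ 0).1 + t • fderiv ℝ Φ (γ 0).1 (deriv (curve γ) 0) := by
  set c := fderiv ℝ Φ (γ 0).1 (deriv (curve γ) 0) with hc
  have hd : ∀ s, HasDerivAt (fun s => Φ (γ s).1 - s • c) 0 s := fun s => by
    have h1 : HasDerivAt (fun s => Φ (γ s).1) (fderiv ℝ Φ (γ s).1 (deriv (curve γ) s)) s :=
      HasFDerivAt.comp_hasDerivAt s (h.hasFDerivAt (γ s).2) (hγ.1 s).hasDerivAt
    rw [h.fderiv_eq_of_isParallelAlong hγ s 0, ← hc] at h1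
    have h2 : HasDerivAt (fun s : ℝ => s • c) c s := by
      simpa using (hasDerivAt_id s).smul_const c
    simpa using h1.fun_sub h2
  have := is_const_of_deriv_eq_zero (fun t => (hd t).differentiableAt) (fun t => (hd t).deriv) t 0
  simp only [zero_smul, sub_zero] at this
  rw [← this]
  abel

/-- The geodesic which is, in the chart, the line through `x` with velocity `Y`. -/
def line {x Y : Mat n} (hx : x ∈ F) (hY : Y ∈ F) : ℝ → SPD n :=
  fun t => ⟨Ψ (x + t • Y), h.posDef _ (add_smul_mem hx hY t)⟩

theorem deriv_curve_line {x Y : Mat n} (hx : x ∈ F) (hY : Y ∈ F) (t : ℝ) :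
    deriv (curve (h.line hx hY)) t = fderiv ℝ Ψ (x + t • Y) Y :=
  (h.hasDerivAt_symm_line x Y t).deriv

theorem isParallelAlong_line {x Y Z : Mat n} (hx : x ∈ F) (hY : Y ∈ F) (hZ : Z ∈ F) :
    IsParallelAlong g (h.line hx hY) (fun t => fderiv ℝ Ψ (x + t • Y) Z) := by
  refine h.isParallelAlong_iff.2 ⟨fun t => (h.hasDerivAt_symm_line x Y t).differentiableAt, ?_,
    fun t => h.isSymm_fderiv_symm (add_smul_mem hx hY t) hZ, fun t => ?_⟩
  · have h1 : Differentiable ℝ (fderiv ℝ Ψ) :=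
      (h.contDiff_symm.fderiv_right (m := 1) (by norm_num)).differentiable one_ne_zero
    fun_prop
  · have : (fun s => fderiv ℝ Φ (h.line hx hY s).1 (fderiv ℝ Ψ (x + s • Y) Z)) = fun _ => Z :=
      funext fun s => h.fderiv_fderiv_symm (add_smul_mem hx hY s) hZ
    rw [this]
    exact hasDerivAt_const t Z

theorem isGeodesic_line {x Y : Mat n} (hx : x ∈ F) (hY : Y ∈ F) :
    IsGeodesic g (h.line hx hY) := by
  have := h.isParallelAlong_line hx hY hY
  rwa [← funext (h.deriv_curve_line hx hY)] at this

theorem map_riemExp (P : SPD n) {W : Mat n} (hW : W.IsSymm) :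
    Φ (riemExp g P W).1 = Φ P.1 + fderiv ℝ Φ P.1 W := by
  have hx := h.mem _ P.2
  have hY := h.fderiv_mem P.2 hW
  have e : riemExp g P W = h.line hx hY 1 := by
    refine epsilon_eq ⟨h.line hx hY, h.isGeodesic_line hx hY, ?_, ?_, rfl⟩ ?_
    · exact Subtype.ext (by simpa [line] using h.left_inv _ P.2)
    · simpa [h.deriv_curve_line] using h.fderiv_symm_fderiv P.2 hW
    · rintro R ⟨γ, hγ, h0, h1, rfl⟩
      refine h.injOn ?_
      rw [h.map_geodesic hγ, h0, h1, line, h.right_inv _ (add_smul_mem hx hY 1)]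
  rw [e, line, h.right_inv _ (add_smul_mem hx hY 1), one_smul]

theorem riemLog_spec (P Q : SPD n) :
    (riemLog g P Q).IsSymm ∧ fderiv ℝ Φ P.1 (riemLog g P Q) = Φ Q.1 - Φ P.1 := by
  obtain ⟨W, hW, hWe⟩ := h.exists_isSymm_fderiv_eq P.2 (F.sub_mem (h.mem _ Q.2) (h.mem _ P.2))
  have e : riemLog g P Q = W := by
    refine epsilon_eq ⟨hW, h.injOn (by rw [h.map_riemExp P hW, hWe]; abel)⟩ ?_
    rintro V ⟨hV, rfl⟩
    refine h.fderiv_injOn P.2 hV hW ?_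
    rw [hWe, h.map_riemExp P hV]
    abel
  rw [e]
  exact ⟨hW, hWe⟩

theorem transport_spec (P Q : SPD n) {W : Mat n} (hW : W.IsSymm) :
    (transport g P Q W).IsSymm ∧ fderiv ℝ Φ Q.1 (transport g P Q W) = fderiv ℝ Φ P.1 W := by
  have hx := h.mem _ P.2
  have hY := F.sub_mem (h.mem _ Q.2) (h.mem _ P.2)
  have hZ := h.fderiv_mem P.2 hW
  have hxY : Φ P.1 + (1 : ℝ) • (Φ Q.1 - Φ P.1) = Φ Q.1 := by rw [one_smul]; abel
  have hZ' := h.fderiv_fderiv_symm (h.mem _ Q.2) hZ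
  rw [h.left_inv _ Q.2] at hZ'
  have hs := h.isSymm_fderiv_symm (h.mem _ Q.2) hZ
  have e : transport g P Q W = fderiv ℝ Ψ (Φ Q.1) (fderiv ℝ Φ P.1 W) := by
    refine epsilon_eq ⟨h.line hx hY, _, h.isGeodesic_line hx hY, ?_, ?_,
      h.isParallelAlong_line hx hY hZ, ?_, ?_⟩ ?_
    · exact Subtype.ext (by simpa [line] using h.left_inv _ P.2)
    · exact Subtype.ext (by simpa only [line, hxY] using h.left_inv _ Q.2)
    · simpa using h.fderiv_symm_fderiv P.2 hW
    · simp only [hxY]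
    · rintro _ ⟨γ, V, hγ, h0, h1, hV, hV0, rfl⟩
      refine h.fderiv_injOn Q.2 (hV.2.2.1 1) hs ?_
      rw [hZ', ← h1, h.fderiv_eq_of_isParallelAlong hV 1 0, h0, hV0]
  rw [e]
  exact ⟨hs, hZ'⟩

/-- In coordinates `Log_I Q` is `Φ Q - Φ I = Φ Q`, transport leaves it unchanged, and `Exp_P` adds
it to `Φ P`. -/
theorem map_gyroAdd (P Q : SPD n) : Φ (gyroAdd g P Q).1 = Φ P.1 + Φ Q.1 := by
  have h1 := h.riemLog_spec (SPD.id n) Q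
  have h2 := h.transport_spec (SPD.id n) P h1.1
  have h3 : Φ (SPD.id n).1 = 0 := h.map_one
  rw [gyroAdd, h.map_riemExp P h2.1, h2.2, h1.2, h3, sub_zero]

theorem spdNorm_eq (P : SPD n) : spdNorm g P = Real.sqrt (frob (Φ P.1) (Φ P.1)) := by
  have h1 := h.riemLog_spec (SPD.id n) P
  have h3 : Φ (SPD.id n).1 = 0 := h.map_one
  rw [spdNorm, spdInner, h.metric_eq _ _ _ (SPD.id n).2 h1.1 h1.1, h1.2, h3, sub_zero]

theorem gyroAdd_eq_id_iff (P R : SPD n) :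
    gyroAdd g R P = SPD.id n ↔ Φ R.1 = -Φ P.1 := by
  have h3 : Φ (SPD.id n).1 = 0 := h.map_one
  constructor
  · intro hR
    rw [eq_neg_iff_add_eq_zero, ← h.map_gyroAdd, hR, h3]
  · intro hR
    exact h.injOn (by rw [h.map_gyroAdd, hR, h3, neg_add_cancel])

theorem existsUnique_gyroAdd_eq_id (P : SPD n) : ∃! R : SPD n, gyroAdd g R P = SPD.id n := by
  have hm := F.neg_mem (h.mem _ P.2)
  refine ⟨⟨Ψ (-Φ P.1), h.posDef _ hm⟩, (h.gyroAdd_eq_id_iff _ _).2 (h.right_inv _ hm), ?_⟩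
  intro R hR
  exact h.injOn (((h.gyroAdd_eq_id_iff _ _).1 hR).trans (h.right_inv _ hm).symm)

theorem isGyroisometry_gyroNeg : IsGyroisometry g (gyroNeg g) := by
  have hneg : ∀ P : SPD n, Φ (gyroNeg g P).1 = -Φ P.1 := fun P =>
    (h.gyroAdd_eq_id_iff _ _).1
      (Classical.epsilon_spec (h.existsUnique_gyroAdd_eq_id P).exists)
  intro P Q
  rw [gyroDist, gyroDist, h.spdNorm_eq, h.spdNorm_eq, h.map_gyroAdd, h.map_gyroAdd, hneg, hneg,
    hneg, ← neg_add, frob_neg_neg]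

end IsFlatChart

/-! ### The logarithm as a flat chart for the Log-Euclidean metric. -/

/-- The symmetric part of a matrix. -/
def symPart (n : ℕ) : Mat n →L[ℝ] Mat n :=
  (1 / 2 : ℝ) • (ContinuousLinearMap.id ℝ (Mat n) + transposeCLM n)

theorem symPart_apply (A : Mat n) : symPart n A = (1 / 2 : ℝ) • (A + Aᵀ) := rfl

theorem isSymm_symPart (A : Mat n) : (symPart n A).IsSymm := by
  rw [IsSymm, symPart_apply, transpose_smul, transpose_add, transpose_transpose, add_comm]

theorem symPart_of_isSymm {A : Mat n} (hA : A.IsSymm) : symPart n A = A := by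
  rw [symPart_apply, hA.eq, ← two_smul ℝ A, smul_smul]
  norm_num

theorem symPart_of_transpose_eq_neg {A : Mat n} (hA : Aᵀ = -A) : symPart n A = 0 := by
  rw [symPart_apply, hA, add_neg_cancel, smul_zero]

/-- The linear space of symmetric matrices. -/
def symSubmodule (n : ℕ) : Submodule ℝ (Mat n) where
  carrier := {A | A.IsSymm}
  add_mem' := fun ha hb => ha.add hb
  zero_mem' := isSymm_zero
  smul_mem' := fun c _ ha => ha.smul c

/-- The matrix logarithm on the symmetric part, the identity on the skew-symmetric part. -/
def logChart (M : Mat n) : Mat n := matLog (symPart n M) + (M - symPart n M)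

/-- The matrix exponential on the symmetric part, the identity on the skew-symmetric part. -/
def expChart (X : Mat n) : Mat n := exp (symPart n X) + (X - symPart n X)

theorem logChart_of_isSymm {M : Mat n} (hM : M.IsSymm) : logChart M = matLog M := by
  rw [logChart, symPart_of_isSymm hM, sub_self, add_zero]

theorem expChart_of_isSymm {M : Mat n} (hM : M.IsSymm) : expChart M = exp M := by
  rw [expChart, symPart_of_isSymm hM, sub_self, add_zero]

theorem symPart_expChart (X : Mat n) : symPart n (expChart X) = exp (symPart n X) := by
  rw [expChart, map_add, map_sub, symPart_of_isSymm (isSymm_symPart X).exp,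
    symPart_of_isSymm (isSymm_symPart X), sub_self, add_zero]

theorem logChart_expChart (X : Mat n) : logChart (expChart X) = X := by
  rw [logChart, symPart_expChart, matLog_exp (isSymm_symPart X), expChart]
  abel

theorem contDiff_expChart {m : WithTop ℕ∞} : ContDiff ℝ m (expChart : Mat n → Mat n) :=
  ((contDiff_exp.of_le le_top).comp (symPart n).contDiff).add
    (contDiff_id.sub (symPart n).contDiff)

/-- Differentiating `exp X * X = X * exp X` along the line shows that `exp a` commutes with `H`. So
does `a`, a function of `exp a`; then `exp (a + tH) = exp a * exp (tH)` has derivative `exp a * H`,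
which must vanish. -/
theorem eq_zero_of_hasDerivAt_exp {a H : Mat n} (ha : a.IsSymm)
    (h : HasDerivAt (fun t : ℝ => exp (a + t • H)) 0 0) : H = 0 := by
  have hl := hasDerivAt_add_smul a H 0
  have h1 := h.fun_mul hl
  have h2 := hl.fun_mul h
  have e : (fun t : ℝ => exp (a + t • H) * (a + t • H)) =
      fun t : ℝ => (a + t • H) * exp (a + t • H) :=
    funext fun t => (Commute.refl (a + t • H)).exp_left.eq
  rw [e] at h1
  have h3 := h1.unique h2
  simp only [zero_smul, add_zero, zero_mul, mul_zero, zero_add] at h3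
  have h4 : Commute (exp a) H := h3
  have h5 : Commute (matLog (exp a)) H := h4.cfc_real Real.log
  rw [matLog_exp ha] at h5
  have h6 : HasDerivAt (fun t : ℝ => exp a * exp (t • H)) (exp a * (exp ((0 : ℝ) • H) * H)) 0 :=
    (hasDerivAt_exp_smul_const H (0 : ℝ)).const_mul (exp a)
  have e' : (fun t : ℝ => exp (a + t • H)) = fun t : ℝ => exp a * exp (t • H) :=
    funext fun t => Matrix.exp_add_of_commute _ _ (h5.smul_right t)
  rw [e'] at h
  have h7 := h.unique h6
  rw [zero_smul, exp_zero, one_mul] at h7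
  calc H = exp (-a) * exp a * H := by rw [exp_neg_mul_exp, one_mul]
    _ = 0 := by rw [mul_assoc, ← h7, mul_zero]

/-- The symmetric part of `v` vanishes by injectivity of the derivative of `exp`; `expChart` is then
a translation in the direction `v`. -/
theorem eq_zero_of_fderiv_expChart_eq_zero {a v : Mat n} (ha : a.IsSymm)
    (h : fderiv ℝ expChart a v = 0) : v = 0 := by
  have h1 := HasFDerivAt.hasDerivAt_add_smul
    (contDiff_expChart.differentiable one_ne_zero a).hasFDerivAt v
  rw [h] at h1
  have h2 : HasDerivAt (fun t : ℝ => symPart n (expChart (a + t • v))) (symPart n 0) 0 :=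
    (symPart n).hasFDerivAt.comp_hasDerivAt 0 h1
  have h3 : (fun t : ℝ => symPart n (expChart (a + t • v))) =
      fun t : ℝ => exp (a + t • symPart n v) := by
    funext t
    rw [symPart_expChart, map_add, map_smul, symPart_of_isSymm ha]
  have h4 : symPart n v = 0 := by
    rw [h3, map_zero] at h2
    exact eq_zero_of_hasDerivAt_exp ha h2
  have h5 : (fun t : ℝ => expChart (a + t • v)) = fun t : ℝ => exp a + t • v := by
    funext t
    rw [expChart, map_add, map_smul, h4, symPart_of_isSymm ha, smul_zero, add_zero,
      add_sub_cancel_left]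
  rw [h5] at h1
  exact (hasDerivAt_add_smul (exp a) v 0).unique h1

/-- Smoothness of the logarithm comes from the inverse function theorem for `expChart` at `matLog
P`. -/
theorem contDiffAt_logChart {P : Mat n} (hP : P.PosDef) : ContDiffAt ℝ 2 logChart P := by
  have h := contDiffAt_of_leftInverse (two_ne_zero (α := WithTop ℕ∞)) contDiff_expChart
    logChart_expChart (fun _ => eq_zero_of_fderiv_expChart_eq_zero (isSymm_matLog P))
  rwa [expChart_of_isSymm (isSymm_matLog P), exp_matLog hP] at h

theorem dLog_eq_fderiv_logChart {P W : Mat n} (hP : P.PosDef) (hW : W.IsSymm) :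
    dLog P W = fderiv ℝ logChart P W := by
  have h1 := HasFDerivAt.hasDerivAt_add_smul
    ((contDiffAt_logChart hP).differentiableAt two_ne_zero).hasFDerivAt W
  have e : (fun t : ℝ => logChart (P + t • W)) = fun t : ℝ => matLog (P + t • W) :=
    funext fun t => logChart_of_isSymm ((isSymm_of_posDef hP).add (hW.smul t))
  rw [e] at h1
  exact h1.deriv

theorem isFlatChart_metricLE (n : ℕ) :
    IsFlatChart (metricLE n) logChart expChart (symSubmodule n) where
  contDiff_symm := contDiff_expChart
  contDiffAt _ hP := contDiffAt_logChart hP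
  mem P hP := by
    rw [logChart_of_isSymm (isSymm_of_posDef hP)]
    exact isSymm_matLog P
  posDef x hx := by
    rw [expChart_of_isSymm hx]
    exact posDef_exp hx
  right_inv x _ := logChart_expChart x
  left_inv P hP := by
    rw [logChart_of_isSymm (isSymm_of_posDef hP), expChart_of_isSymm (isSymm_matLog P),
      exp_matLog hP]
  metric_eq P W V hP hW hV := by
    rw [metricLE, dLog_eq_fderiv_logChart hP hW, dLog_eq_fderiv_logChart hP hV]
  map_one := by
    rw [logChart_of_isSymm isSymm_one, ← exp_zero, matLog_exp isSymm_zero]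

/-! ### The Affine-Invariant metric. -/

theorem HasDerivAt.matInv {f : ℝ → Mat n} {f' : Mat n} {t : ℝ} (h : HasDerivAt f f' t)
    (hu : IsUnit (f t)) : HasDerivAt (fun s => (f s)⁻¹) (-((f t)⁻¹ * f' * (f t)⁻¹)) t := by
  obtain ⟨u, hu⟩ := hu
  have h1 := hasFDerivAt_ringInverse (𝕜 := ℝ) u
  rw [hu] at h1
  have h2 := HasFDerivAt.comp_hasDerivAt t h1 h
  have h3 : (↑u⁻¹ : Mat n) = (f t)⁻¹ := by rw [← hu, coe_units_inv]
  rw [h3] at h2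
  have e : (fun s => (f s)⁻¹) = Ring.inverse ∘ f := funext fun s => nonsing_inv_eq_ringInverse _
  rw [e]
  exact h2

/-- The symmetric positive definite square root. -/
def root (P : Mat n) : Mat n := exp ((1 / 2 : ℝ) • matLog P)

/-- The inverse of the square root. -/
def rootInv (P : Mat n) : Mat n := exp (-((1 / 2 : ℝ) • matLog P))

theorem root_mul_rootInv (P : Mat n) : root P * rootInv P = 1 := exp_mul_exp_neg _

theorem rootInv_mul_root (P : Mat n) : rootInv P * root P = 1 := exp_neg_mul_exp _

theorem root_mul_root {P : Mat n} (hP : P.PosDef) : root P * root P = P := by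
  rw [root, exp_half_mul_exp_half, exp_matLog hP]

theorem isSymm_root (P : Mat n) : (root P).IsSymm := ((isSymm_matLog P).smul _).exp

theorem isSymm_rootInv (P : Mat n) : (rootInv P).IsSymm := ((isSymm_matLog P).smul _).neg.exp

theorem rootInv_mul_rootInv {P : Mat n} (hP : P.PosDef) : rootInv P * rootInv P = P⁻¹ := by
  refine (Matrix.inv_eq_right_inv ?_).symm
  calc P * (rootInv P * rootInv P)
      = root P * (root P * rootInv P) * rootInv P := by
        nth_rewrite 1 [← root_mul_root hP]
        noncomm_ring
    _ = 1 := by rw [root_mul_rootInv, mul_one, root_mul_rootInv]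

theorem isSymm_conj {R X : Mat n} (hR : R.IsSymm) (hX : X.IsSymm) : (R * X * R).IsSymm := by
  rw [IsSymm, transpose_mul, transpose_mul, hR.eq, hX.eq, mul_assoc]

theorem posDef_conj {R P : Mat n} (hR : R.IsSymm) (hu : IsUnit R) (hP : P.PosDef) :
    (R * P * R).PosDef := by
  have := posDef_mul_mul_transpose hP hu
  rwa [hR.eq] at this

theorem isUnit_root (P : Mat n) : IsUnit (root P) := Matrix.isUnit_exp _

theorem matLog_inv {P : Mat n} (hP : P.PosDef) : matLog P⁻¹ = -matLog P := by
  have : P⁻¹ = exp (-matLog P) := by rw [Matrix.exp_neg, exp_matLog hP]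
  rw [this, matLog_exp (isSymm_matLog P).neg]

theorem root_inv {P : Mat n} (hP : P.PosDef) : root P⁻¹ = rootInv P := by
  rw [root, matLog_inv hP, smul_neg, rootInv]

theorem dMetric_metricAI {P : Mat n} (hP : P.PosDef) (Z W V : Mat n) :
    dMetric (metricAI n) P Z W V =
      -(P⁻¹ * Z * P⁻¹ * W * P⁻¹ * V).trace - (P⁻¹ * W * P⁻¹ * Z * P⁻¹ * V).trace := by
  have h0 := HasDerivAt.matInv (hasDerivAt_add_smul P Z 0) (by simpa using hP.isUnit)
  have h1 := HasDerivAt.matTrace (((h0.mul_const W).fun_mul h0).mul_const V)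
  refine h1.deriv.trans ?_
  simp only [zero_smul, add_zero, neg_mul, mul_neg, add_mul, trace_add, trace_neg, mul_assoc]
  ring

/-- Cyclicity of the trace leaves only two distinct traces. The outcome is `∇_W V = -½ (W P⁻¹ V + V
P⁻¹ W)` for constant fields. -/
theorem christoffel_metricAI {P : Mat n} (hP : P.PosDef) (W V Z : Mat n) :
    christoffel (metricAI n) P W V Z =
      -(P⁻¹ * ((1 / 2 : ℝ) • (W * P⁻¹ * V + V * P⁻¹ * W)) * P⁻¹ * Z).trace := by
  have h1 : (P⁻¹ * Z * P⁻¹ * W * P⁻¹ * V).trace = (P⁻¹ * W * P⁻¹ * V * P⁻¹ * Z).trace := by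
    have := trace_mul_comm (P⁻¹ * Z) (P⁻¹ * W * P⁻¹ * V)
    simpa only [mul_assoc] using this
  have h2 : (P⁻¹ * W * P⁻¹ * Z * P⁻¹ * V).trace = (P⁻¹ * V * P⁻¹ * W * P⁻¹ * Z).trace := by
    have := trace_mul_comm (P⁻¹ * W * P⁻¹ * Z) (P⁻¹ * V)
    simpa only [mul_assoc] using this
  rw [christoffel, dMetric_metricAI hP, dMetric_metricAI hP, dMetric_metricAI hP, h1, h2]
  simp only [Matrix.mul_smul, Matrix.smul_mul, mul_add, add_mul, trace_add, trace_smul, mul_assoc,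
    smul_eq_mul]
  ring

/-- Conjugation by the inverse square root of `P` turns the metric at `P` into the Frobenius
product. -/
theorem eq_zero_of_metricAI_self {P U : Mat n} (hP : P.PosDef) (hU : U.IsSymm)
    (h : metricAI n P U U = 0) : U = 0 := by
  have h1 : frob (rootInv P * U * rootInv P) (rootInv P * U * rootInv P) = 0 := by
    rw [← h, metricAI, frob, (isSymm_conj (isSymm_rootInv P) hU).eq, ← rootInv_mul_rootInv hP,
      mul_assoc, mul_assoc, trace_mul_comm, ← trace_mul_comm U]
    simp only [mul_assoc]
  have h2 := frob_self_eq_zero h1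
  calc U = (root P * rootInv P) * U * (rootInv P * root P) := by
        rw [root_mul_rootInv, rootInv_mul_root, one_mul, mul_one]
    _ = root P * (rootInv P * U * rootInv P) * root P := by noncomm_ring
    _ = 0 := by rw [h2, mul_zero, zero_mul]

theorem isParallelAlong_metricAI_iff {γ : ℝ → SPD n} {V : ℝ → Mat n} :
    IsParallelAlong (metricAI n) γ V ↔ Differentiable ℝ (curve γ) ∧ Differentiable ℝ V ∧
      (∀ t, (V t).IsSymm) ∧ ∀ t, deriv V t = (1 / 2 : ℝ) •
        (deriv (curve γ) t * (γ t).1⁻¹ * V t + V t * (γ t).1⁻¹ * deriv (curve γ) t) := by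
  refine and_congr_right fun hγ => and_congr_right fun hV => and_congr_right fun hs =>
    forall_congr' fun t => ?_
  have hγs : (deriv (curve γ) t).IsSymm :=
    isSymm_of_hasDerivAt (hγ t).hasDerivAt fun s => isSymm_of_posDef (γ s).2
  have hVs : (deriv V t).IsSymm := isSymm_of_hasDerivAt (hV t).hasDerivAt hs
  set N : Mat n := (1 / 2 : ℝ) •
    (deriv (curve γ) t * (γ t).1⁻¹ * V t + V t * (γ t).1⁻¹ * deriv (curve γ) t) with hN
  have hNs : N.IsSymm := by
    have hi : (γ t).1⁻¹.IsSymm := isSymm_of_posDef (γ t).2.inv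
    rw [IsSymm, hN, transpose_smul, transpose_add]
    simp only [transpose_mul, hi.eq, hγs.eq, (hs t).eq, mul_assoc]
    rw [add_comm]
  have key : ∀ Z : Mat n, metricAI n (γ t).1 (deriv V t) Z +
      christoffel (metricAI n) (γ t).1 (deriv (curve γ) t) (V t) Z =
        metricAI n (γ t).1 (deriv V t - N) Z := fun Z => by
    rw [christoffel_metricAI (γ t).2, ← hN]
    simp only [metricAI, mul_sub, sub_mul, trace_sub]
    ring
  constructor
  · intro h0
    -- The defect of the transport equation is itself symmetric, so it serves as its own test
    -- vector.
    have h1 := h0 _ (hVs.sub hNs)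
    rw [key] at h1
    exact sub_eq_zero.1 (eq_zero_of_metricAI_self (γ t).2 (hVs.sub hNs) h1)
  · intro h0 Z _
    rw [key, h0, sub_self]
    simp [metricAI]

/-- The product `c t * exp (-tC)` is conserved, which gives uniqueness for this linear equation. -/
theorem eq_mul_exp_of_deriv {c : ℝ → Mat n} {C : Mat n}
    (h : ∀ t, HasDerivAt c (c t * C) t) (t : ℝ) : c t = c 0 * exp (t • C) := by
  have hd : ∀ s : ℝ, HasDerivAt (fun s => c s * exp (s • -C)) 0 s := fun s => by
    have h1 := (h s).fun_mul (hasDerivAt_exp_smul_const' (-C) s)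
    exact h1.congr_deriv (by noncomm_ring)
  have h1 := is_const_of_deriv_eq_zero (fun s => (hd s).differentiableAt) (fun s => (hd s).deriv)
    t 0
  simp only [zero_smul, exp_zero, mul_one] at h1
  rw [← h1, smul_neg, mul_assoc, exp_neg_mul_exp, mul_one]

/-- The geodesic equation is `γ'' = γ' γ⁻¹ γ'`, which says exactly that `γ⁻¹ γ'` is conserved. -/
theorem deriv_geodesic_metricAI {γ : ℝ → SPD n} (hγ : IsGeodesic (metricAI n) γ) (t : ℝ) :
    deriv (curve γ) t = (γ t).1 * ((γ 0).1⁻¹ * deriv (curve γ) 0) := by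
  obtain ⟨h1, h2, -, h4⟩ := isParallelAlong_metricAI_iff.1 hγ
  have hu : ∀ s, IsUnit (curve γ s) := fun s => (γ s).2.isUnit
  have hd : ∀ s, HasDerivAt (fun s => (curve γ s)⁻¹ * deriv (curve γ) s) 0 s := fun s => by
    have h5 := (HasDerivAt.matInv (h1 s).hasDerivAt (hu s)).fun_mul (h2 s).hasDerivAt
    refine h5.congr_deriv ?_
    rw [h4 s, ← two_smul ℝ, smul_smul]
    simp only [curve]
    norm_num
    noncomm_ring
  have h5 := is_const_of_deriv_eq_zero (fun s => (hd s).differentiableAt) (fun s => (hd s).deriv)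
    t 0
  change (γ t).1⁻¹ * _ = (γ 0).1⁻¹ * _ at h5
  rw [← h5, ← mul_assoc, Matrix.mul_nonsing_inv _ ((isUnit_iff_isUnit_det _).1 (γ t).2.isUnit),
    one_mul]

theorem geodesic_metricAI_eq {γ : ℝ → SPD n} (hγ : IsGeodesic (metricAI n) γ) (t : ℝ) :
    (γ t).1 = (γ 0).1 * exp (t • ((γ 0).1⁻¹ * deriv (curve γ) 0)) := by
  refine eq_mul_exp_of_deriv (c := curve γ) (fun s => ?_) t
  have := (hγ.1 s).hasDerivAt
  rwa [deriv_geodesic_metricAI hγ s] at this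

theorem hasDerivAt_exp_smul (S : Mat n) (t : ℝ) :
    HasDerivAt (fun t : ℝ => exp (t • S)) (exp (t • S) * S) t :=
  hasDerivAt_exp_smul_const S t

/-- The geodesic through `P` with initial velocity `√P S √P`. -/
def geodesicAI (P : SPD n) {S : Mat n} (hS : S.IsSymm) : ℝ → SPD n := fun t =>
  ⟨root P.1 * exp (t • S) * root P.1,
    posDef_conj (isSymm_root _) (isUnit_root _) (posDef_exp (hS.smul t))⟩

theorem hasDerivAt_geodesicAI (P : SPD n) {S : Mat n} (hS : S.IsSymm) (t : ℝ) :
    HasDerivAt (curve (geodesicAI P hS)) (root P.1 * (exp (t • S) * S) * root P.1) t :=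
  ((hasDerivAt_exp_smul S t).const_mul (root P.1)).mul_const (root P.1)

theorem inv_geodesicAI (P : SPD n) {S : Mat n} (hS : S.IsSymm) (t : ℝ) :
    (geodesicAI P hS t).1⁻¹ = rootInv P.1 * exp (-(t • S)) * rootInv P.1 := by
  refine Matrix.inv_eq_right_inv ?_
  calc root P.1 * exp (t • S) * root P.1 * (rootInv P.1 * exp (-(t • S)) * rootInv P.1)
      = root P.1 * exp (t • S) * (root P.1 * rootInv P.1) * exp (-(t • S)) * rootInv P.1 := by
        noncomm_ring
    _ = root P.1 * (exp (t • S) * exp (-(t • S))) * rootInv P.1 := by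
        rw [root_mul_rootInv]
        noncomm_ring
    _ = 1 := by rw [exp_mul_exp_neg, mul_one, root_mul_rootInv]

/-- Differentiation puts half of `S` on each side of `X`, matching the two terms of the transport
equation because `S` commutes with its exponentials. With `X = S` the field is the velocity of the
curve, so the curve is a geodesic. -/
theorem isParallelAlong_geodesicAI (P : SPD n) {S X : Mat n} (hS : S.IsSymm) (hX : X.IsSymm) :
    IsParallelAlong (metricAI n) (geodesicAI P hS)
      (fun t => root P.1 * (exp (t • (1 / 2 : ℝ) • S) * X * exp (t • (1 / 2 : ℝ) • S)) *
        root P.1) := by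
  have hV : ∀ t : ℝ, HasDerivAt
      (fun t : ℝ => root P.1 * (exp (t • (1 / 2 : ℝ) • S) * X * exp (t • (1 / 2 : ℝ) • S)) *
        root P.1)
      (root P.1 * (exp (t • (1 / 2 : ℝ) • S) * ((1 / 2 : ℝ) • S) * X * exp (t • (1 / 2 : ℝ) • S) +
        exp (t • (1 / 2 : ℝ) • S) * X * (exp (t • (1 / 2 : ℝ) • S) * ((1 / 2 : ℝ) • S))) *
          root P.1) t := fun t => by
    have h1 := hasDerivAt_exp_smul ((1 / 2 : ℝ) • S) t
    exact (((h1.mul_const X).fun_mul h1).const_mul (root P.1)).mul_const (root P.1)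
  refine isParallelAlong_metricAI_iff.2 ⟨fun t => (hasDerivAt_geodesicAI P hS t).differentiableAt,
    fun t => (hV t).differentiableAt, fun t => ?_, fun t => ?_⟩
  · exact isSymm_conj (isSymm_root _) (isSymm_conj ((hS.smul _).smul t).exp hX)
  · rw [(hV t).deriv, (hasDerivAt_geodesicAI P hS t).deriv, inv_geodesicAI]
    set R := root P.1
    set R' := rootInv P.1
    set e := exp (t • (1 / 2 : ℝ) • S) with he
    have h1 : R * R' = 1 := root_mul_rootInv _
    have h2 : R' * R = 1 := rootInv_mul_root _
    have h3 : S * e = e * S :=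
      (((Commute.refl S).smul_right (1 / 2 : ℝ)).smul_right t).exp_right.eq
    have h4 : exp (t • S) * exp (-(t • S)) = 1 := exp_mul_exp_neg _
    have h5 : exp (-(t • S)) * exp (t • S) = 1 := exp_neg_mul_exp _
    have h6 : S * exp (t • S) = exp (t • S) * S := ((Commute.refl S).smul_right t).exp_right.eq
    have h7 : S * exp (-(t • S)) = exp (-(t • S)) * S :=
      ((Commute.refl S).smul_right t).neg_right.exp_right.eq
    have hl : R * (exp (t • S) * S) * R * (R' * exp (-(t • S)) * R') = R * S * R' := by
      calc _ = R * exp (t • S) * S * (R * R') * exp (-(t • S)) * R' := by noncomm_ring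
        _ = R * exp (t • S) * (S * exp (-(t • S))) * R' := by rw [h1]; noncomm_ring
        _ = R * (exp (t • S) * exp (-(t • S))) * S * R' := by rw [h7]; noncomm_ring
        _ = _ := by rw [h4, mul_one]
    have hr : R' * exp (-(t • S)) * R' * (R * (exp (t • S) * S) * R) = R' * S * R := by
      calc _ = R' * exp (-(t • S)) * (R' * R) * exp (t • S) * S * R := by noncomm_ring
        _ = R' * (exp (-(t • S)) * exp (t • S)) * S * R := by rw [h2]; noncomm_ring
        _ = _ := by rw [h5, mul_one]
    rw [hl, mul_assoc (R * (e * X * e) * R), hr]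
    have e1 : R * S * R' * (R * (e * X * e) * R) = R * (e * S * X * e) * R := by
      calc _ = R * S * (R' * R) * e * X * e * R := by noncomm_ring
        _ = R * (S * e) * X * e * R := by rw [h2]; noncomm_ring
        _ = _ := by rw [h3]; noncomm_ring
    have e2 : R * (e * X * e) * R * (R' * S * R) = R * (e * X * (e * S)) * R := by
      calc _ = R * e * X * e * (R * R') * S * R := by noncomm_ring
        _ = _ := by rw [h1]; noncomm_ring
    rw [e1, e2]
    simp only [Matrix.mul_smul, Matrix.smul_mul, mul_add, add_mul, smul_add]

theorem isGeodesic_geodesicAI (P : SPD n) {S : Mat n} (hS : S.IsSymm) :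
    IsGeodesic (metricAI n) (geodesicAI P hS) := by
  have h := isParallelAlong_geodesicAI P hS hS
  have e : deriv (curve (geodesicAI P hS)) = fun t =>
      root P.1 * (exp (t • (1 / 2 : ℝ) • S) * S * exp (t • (1 / 2 : ℝ) • S)) * root P.1 := by
    funext t
    have h3 : S * exp (t • (1 / 2 : ℝ) • S) = exp (t • (1 / 2 : ℝ) • S) * S :=
      (((Commute.refl S).smul_right (1 / 2 : ℝ)).smul_right t).exp_right.eq
    rw [(hasDerivAt_geodesicAI P hS t).deriv, mul_assoc _ S, h3, ← mul_assoc (exp _) (exp _),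
      smul_comm t, exp_half_mul_exp_half]
  rwa [← e] at h

theorem riemExp_metricAI (P : SPD n) {S : Mat n} (hS : S.IsSymm) :
    riemExp (metricAI n) P (root P.1 * S * root P.1) = geodesicAI P hS 1 := by
  have h0 : geodesicAI P hS 0 = P := Subtype.ext (by
    simp only [geodesicAI, zero_smul, exp_zero, mul_one]
    exact root_mul_root P.2)
  have h1 : deriv (curve (geodesicAI P hS)) 0 = root P.1 * S * root P.1 := by
    rw [(hasDerivAt_geodesicAI P hS 0).deriv, zero_smul, exp_zero, one_mul]
  refine epsilon_eq ⟨_, isGeodesic_geodesicAI P hS, h0, h1, rfl⟩ ?_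
  rintro R ⟨γ, hγ, h2, h3, rfl⟩
  refine Subtype.ext ?_
  rw [geodesic_metricAI_eq hγ, geodesic_metricAI_eq (isGeodesic_geodesicAI P hS), h0, h1, h2, h3]

theorem matLog_one : matLog (1 : Mat n) = 0 := by
  rw [← exp_zero, matLog_exp isSymm_zero]

theorem root_one : root (1 : Mat n) = 1 := by
  rw [root, matLog_one, smul_zero, exp_zero]

theorem riemExp_metricAI_id {S : Mat n} (hS : S.IsSymm) :
    (riemExp (metricAI n) (SPD.id n) S).1 = exp S := by
  have h := congrArg Subtype.val (riemExp_metricAI (SPD.id n) hS)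
  simpa only [SPD.id, geodesicAI, root_one, one_mul, mul_one, one_smul] using h

theorem riemLog_metricAI_id (Q : SPD n) : riemLog (metricAI n) (SPD.id n) Q = matLog Q.1 := by
  refine epsilon_eq ⟨isSymm_matLog _, Subtype.ext ?_⟩ ?_
  · rw [riemExp_metricAI_id (isSymm_matLog _), exp_matLog Q.2]
  · rintro W ⟨hW, rfl⟩
    rw [riemExp_metricAI_id hW, matLog_exp hW]

theorem transport_metricAI_id (P : SPD n) {X : Mat n} (hX : X.IsSymm) :
    transport (metricAI n) (SPD.id n) P X = root P.1 * X * root P.1 := by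
  have hS := isSymm_matLog P.1
  refine epsilon_eq ⟨geodesicAI (SPD.id n) hS, _, isGeodesic_geodesicAI _ hS, ?_, ?_,
    isParallelAlong_geodesicAI _ hS hX, ?_, ?_⟩ ?_
  · exact Subtype.ext (by simp [geodesicAI, SPD.id, root_one])
  · exact Subtype.ext (by simp [geodesicAI, SPD.id, root_one, exp_matLog P.2])
  · simp [SPD.id, root_one]
  · simp only [SPD.id, root_one, one_mul, mul_one, one_smul]
    rfl
  · rintro _ ⟨γ, V, hγ, h0, h1, hV, rfl, rfl⟩
    set C := deriv (curve γ) 0 with hC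
    have hCs : C.IsSymm := hγ.2.2.1 0
    have h0' : (γ 0).1 = 1 := by rw [h0, SPD.id]
    have hγe : ∀ t, (γ t).1 = exp (t • C) := fun t => by
      rw [geodesic_metricAI_eq hγ t, h0', inv_one, one_mul, one_mul]
    -- The endpoint determines the initial velocity, so the connecting geodesic is unique.
    have hPC : matLog P.1 = C := by rw [← h1, hγe, one_smul, matLog_exp hCs]
    obtain ⟨-, h2, -, h4⟩ := isParallelAlong_metricAI_iff.1 hV
    have hu : ∀ t, IsUnit (γ t).1.det := fun t => (isUnit_iff_isUnit_det _).1 (γ t).2.isUnit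
    have h5 : ∀ t, deriv (curve γ) t = (γ t).1 * C := fun t => by
      rw [deriv_geodesic_metricAI hγ t, h0', inv_one, one_mul]
    have h5' : ∀ t, (γ t).1 * C = C * (γ t).1 := fun t => by
      rw [hγe]
      exact ((Commute.refl C).smul_left t).exp_left.eq
    have h6 : ∀ t, deriv V t = (1 / 2 : ℝ) • (C * V t + V t * C) := fun t => by
      rw [h4, h5, h5', mul_assoc C, Matrix.mul_nonsing_inv _ (hu t), mul_one, ← h5', ← mul_assoc,
        mul_assoc (V t), Matrix.nonsing_inv_mul _ (hu t), mul_one]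
    set D : Mat n := -((1 / 2 : ℝ) • C) with hD
    -- Along `exp (tC)` the transport equation reads `V' = ½ (C V + V C)`, so conjugating `V` by
    -- `exp (-tC/2)` gives a conserved quantity; its values at `0` and `1` determine `V 1`.
    have hd : ∀ s : ℝ, HasDerivAt (fun s => exp (s • D) * V s * exp (s • D)) 0 s := fun s => by
      have h7 := ((hasDerivAt_exp_smul D s).fun_mul (h2 s).hasDerivAt).fun_mul
        (hasDerivAt_exp_smul_const' D s)
      refine h7.congr_deriv ?_
      have hV' : deriv V s = -(D * V s + V s * D) := by
        rw [h6, hD]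
        simp only [Matrix.neg_mul, Matrix.mul_neg, Matrix.smul_mul, Matrix.mul_smul, smul_add]
        abel
      rw [hV']
      noncomm_ring
    have h7 := is_const_of_deriv_eq_zero (fun s => (hd s).differentiableAt)
      (fun s => (hd s).deriv) 1 0
    simp only [zero_smul, exp_zero, mul_one, one_mul, one_smul] at h7
    have h8 : exp D = rootInv P.1 := by rw [rootInv, hPC]
    rw [← h7, h8]
    calc V 1 = (root P.1 * rootInv P.1) * V 1 * (rootInv P.1 * root P.1) := by
          rw [root_mul_rootInv, rootInv_mul_root, one_mul, mul_one]
      _ = _ := by noncomm_ring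

theorem gyroAdd_metricAI (P Q : SPD n) :
    (gyroAdd (metricAI n) P Q).1 = root P.1 * Q.1 * root P.1 := by
  rw [gyroAdd, riemLog_metricAI_id, transport_metricAI_id P (isSymm_matLog _),
    riemExp_metricAI P (isSymm_matLog _)]
  simp only [geodesicAI, one_smul, exp_matLog Q.2]

theorem spdNorm_metricAI (P : SPD n) :
    spdNorm (metricAI n) P = Real.sqrt (matLog P.1 * matLog P.1).trace := by
  rw [spdNorm, spdInner, riemLog_metricAI_id, metricAI, SPD.id, inv_one, one_mul, mul_one]

theorem gyroAdd_metricAI_eq_id_iff (P R : SPD n) :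
    gyroAdd (metricAI n) R P = SPD.id n ↔ R.1 = P.1⁻¹ := by
  rw [← Subtype.coe_inj, gyroAdd_metricAI]
  change root R.1 * P.1 * root R.1 = 1 ↔ _
  constructor
  · intro h
    refine (Matrix.inv_eq_left_inv ?_).symm
    have h1 : root R.1 * (P.1 * root R.1) = 1 := by rwa [← mul_assoc]
    -- One-sided inverses of square matrices are two-sided, so one factor `√R` moves across and
    -- joins the other to form `R`.
    have h2 := mul_eq_one_comm.1 h1
    rw [mul_assoc] at h2
    rw [← root_mul_root R.2]
    exact mul_eq_one_comm.1 h2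
  · intro h
    have h1 : root R.1 * root R.1 * P.1 = 1 := by
      rw [root_mul_root R.2, h, Matrix.nonsing_inv_mul _ ((isUnit_iff_isUnit_det _).1 P.2.isUnit)]
    rw [mul_assoc] at h1
    exact mul_eq_one_comm.1 h1

theorem existsUnique_gyroAdd_metricAI_eq_id (P : SPD n) :
    ∃! R : SPD n, gyroAdd (metricAI n) R P = SPD.id n :=
  ⟨⟨P.1⁻¹, P.2.inv⟩, (gyroAdd_metricAI_eq_id_iff _ _).2 rfl,
    fun _ hR => Subtype.ext ((gyroAdd_metricAI_eq_id_iff _ _).1 hR)⟩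

/-- The matrices `√P⁻¹ Q √P⁻¹` and `√P Q⁻¹ √P` are mutually inverse, and the norm sees only the
square of the logarithm. -/
theorem isGyroisometry_gyroNeg_metricAI :
    IsGyroisometry (metricAI n) (gyroNeg (metricAI n)) := by
  have hneg : ∀ P : SPD n, (gyroNeg (metricAI n) P).1 = P.1⁻¹ := fun P =>
    (gyroAdd_metricAI_eq_id_iff _ _).1
      (Classical.epsilon_spec (existsUnique_gyroAdd_metricAI_eq_id P).exists)
  intro P Q
  have hQ : rootInv P.1 * Q.1 * rootInv P.1 = (root P.1 * Q.1⁻¹ * root P.1)⁻¹ := by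
    refine (Matrix.inv_eq_right_inv ?_).symm
    calc _ = root P.1 * Q.1⁻¹ * (root P.1 * rootInv P.1) * Q.1 * rootInv P.1 := by noncomm_ring
      _ = root P.1 * (Q.1⁻¹ * Q.1) * rootInv P.1 := by
        rw [root_mul_rootInv]
        noncomm_ring
      _ = 1 := by
        rw [Matrix.nonsing_inv_mul _ ((isUnit_iff_isUnit_det _).1 Q.2.isUnit), mul_one,
          root_mul_rootInv]
  rw [gyroDist, gyroDist, spdNorm_metricAI, spdNorm_metricAI, gyroAdd_metricAI, gyroAdd_metricAI,
    hneg, hneg, hneg, nonsing_inv_nonsing_inv _ ((isUnit_iff_isUnit_det _).1 P.2.isUnit),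
    root_inv P.2, hQ, matLog_inv (posDef_conj (isSymm_root _) (isUnit_root _) Q.2.inv),
    neg_mul_neg]

/-! ### Lower triangular matrices and the Cholesky factorisation. -/

/-- The linear space of lower triangular matrices. -/
def lowerSubmodule (n : ℕ) : Submodule ℝ (Mat n) where
  carrier := {A | A.BlockTriangular OrderDual.toDual}
  add_mem' := fun ha hb => ha.add hb
  zero_mem' := blockTriangular_zero
  smul_mem' := fun c A ha i j hij => by simp [ha hij]

theorem mem_lowerSubmodule {A : Mat n} : A ∈ lowerSubmodule n ↔ ∀ i j, i < j → A i j = 0 :=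
  ⟨fun h _ _ hij => h hij, fun h i j hij => h i j hij⟩

theorem mul_mem_lowerSubmodule {A B : Mat n} (hA : A ∈ lowerSubmodule n)
    (hB : B ∈ lowerSubmodule n) : A * B ∈ lowerSubmodule n :=
  BlockTriangular.mul hA hB

theorem mul_apply_self_of_lower {A B : Mat n} (hA : A ∈ lowerSubmodule n)
    (hB : B ∈ lowerSubmodule n) (i : Fin n) : (A * B) i i = A i i * B i i := by
  rw [mul_apply]
  refine Finset.sum_eq_single i (fun j _ hj => ?_) (by simp)
  rcases lt_or_gt_of_ne hj with h | h
  · rw [mem_lowerSubmodule.1 hB j i h, mul_zero]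
  · rw [mem_lowerSubmodule.1 hA i j h, zero_mul]

theorem isUnit_det_of_lower {L : Mat n} (hL : L ∈ lowerSubmodule n) (hd : ∀ i, 0 < L i i) :
    IsUnit L.det := by
  rw [det_of_isLowerTriangular L hL]
  exact (Finset.prod_pos fun i _ => hd i).ne'.isUnit

theorem inv_mem_lowerSubmodule {L : Mat n} (hL : L ∈ lowerSubmodule n) (hu : IsUnit L.det) :
    L⁻¹ ∈ lowerSubmodule n := by
  have := invertibleOfIsUnitDet L hu
  exact blockTriangular_inv_of_blockTriangular hL

theorem isCholesky_iff {P L : Mat n} :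
    IsCholesky P L ↔ L ∈ lowerSubmodule n ∧ (∀ i, 0 < L i i) ∧ L * Lᵀ = P := by
  rw [mem_lowerSubmodule, IsCholesky]

/-- The quotient `M⁻¹ L` is lower triangular and orthogonal, so its transpose, being its inverse, is
lower triangular too. It is therefore diagonal, with positive entries of square one. -/
theorem IsCholesky.unique {P L M : Mat n} (hL : IsCholesky P L) (hM : IsCholesky P M) : L = M := by
  obtain ⟨hL1, hL2, hL3⟩ := isCholesky_iff.1 hL
  obtain ⟨hM1, hM2, hM3⟩ := isCholesky_iff.1 hM
  have huL := isUnit_det_of_lower hL1 hL2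
  have huM := isUnit_det_of_lower hM1 hM2
  set A := M⁻¹ * L with hA
  have hAl : A ∈ lowerSubmodule n := mul_mem_lowerSubmodule (inv_mem_lowerSubmodule hM1 huM) hL1
  have hLA : L = M * A := by rw [hA, mul_nonsing_inv_cancel_left _ _ huM]
  have hAA : A * Aᵀ = 1 := by
    rw [hA, transpose_mul, mul_assoc, ← mul_assoc L, hL3, ← hM3, mul_assoc,
      ← transpose_mul, Matrix.nonsing_inv_mul _ huM, transpose_one, mul_one,
      Matrix.nonsing_inv_mul _ huM]
  have hAu : IsUnit A.det := by
    refine (isUnit_iff_isUnit_det _).1 (IsUnit.of_mul_eq_one _ hAA)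
  have hAt : Aᵀ ∈ lowerSubmodule n := by
    rw [← Matrix.inv_eq_right_inv hAA]
    exact inv_mem_lowerSubmodule hAl hAu
  have hAd : ∀ i, 0 < A i i := fun i => by
    have h := hL2 i
    rw [hLA, mul_apply_self_of_lower hM1 hAl] at h
    exact (pos_iff_pos_of_mul_pos h).1 (hM2 i)
  have hA1 : A = 1 := by
    ext i j
    rcases lt_trichotomy i j with h | rfl | h
    · rw [mem_lowerSubmodule.1 hAl i j h, one_apply_ne h.ne]
    · have h1 := congrFun (congrFun hAA i) i
      rw [mul_apply_self_of_lower hAl hAt, transpose_apply, one_apply_eq] at h1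
      rw [one_apply_eq]
      nlinarith [hAd i]
    · have h1 := mem_lowerSubmodule.1 hAt j i h
      rw [transpose_apply] at h1
      rw [h1, one_apply_ne h.ne']
  rw [hLA, hA1, mul_one]

theorem exists_isCholesky {P : Mat n} (hP : P.PosDef) : ∃ L, IsCholesky P L := by
  set K := LDL.lowerInv hP with hK
  have hKl : K ∈ lowerSubmodule n :=
    mem_lowerSubmodule.2 fun i j hij => LDL.lowerInv_triangular hP hij
  have hKu : IsUnit K := isUnit_of_invertible _
  have hKu' : IsUnit K.det := (isUnit_iff_isUnit_det _).1 hKu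
  set d := LDL.diagEntries hP with hd
  have hdp : ∀ i, 0 < d i := by
    have h1 : (diagonal d).PosDef := by
      have h2 : diagonal d = K * P * Kᵀ := by
        rw [← conjTranspose_eq_transpose_of_trivial]
        exact LDL.diag_eq_lowerInv_conj hP
      rw [h2]
      exact posDef_mul_mul_transpose hP hKu
    exact posDef_diagonal_iff.1 h1
  have hPe : K⁻¹ * diagonal d * (K⁻¹)ᵀ = P := by
    rw [← conjTranspose_eq_transpose_of_trivial]
    exact LDL.lower_conj_diag hP
  have hKi := inv_mem_lowerSubmodule hKl hKu'
  have hKd : ∀ i, K⁻¹ i i ≠ 0 := fun i h0 => by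
    have h1 := mul_apply_self_of_lower hKi hKl i
    rw [Matrix.nonsing_inv_mul _ hKu', one_apply_eq, h0, zero_mul] at h1
    exact one_ne_zero h1
  -- The columns of the LDL factor are scaled by the roots of the diagonal entries. Its diagonal is
  -- only known to be nonzero; the signs make it positive and disappear on squaring.
  refine ⟨K⁻¹ * diagonal fun i => SignType.sign (K⁻¹ i i) * Real.sqrt (d i),
    isCholesky_iff.2 ⟨mul_mem_lowerSubmodule hKi (blockTriangular_diagonal _), fun i => ?_, ?_⟩⟩
  · rw [mul_diagonal, ← mul_assoc, mul_comm (K⁻¹ i i), sign_mul_self]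
    exact mul_pos (abs_pos.2 (hKd i)) (Real.sqrt_pos.2 (hdp i))
  · rw [transpose_mul, diagonal_transpose, mul_assoc, ← mul_assoc (diagonal _), diagonal_mul_diagonal,
      ← mul_assoc]
    have : (fun i => (SignType.sign (K⁻¹ i i) * Real.sqrt (d i) : ℝ) *
        (SignType.sign (K⁻¹ i i) * Real.sqrt (d i))) = d := by
      funext i
      rw [mul_mul_mul_comm, Real.mul_self_sqrt (hdp i).le]
      rcases lt_or_gt_of_ne (hKd i) with h | h <;> simp [h]
    rw [this, hPe]

theorem isCholesky_chol {P : Mat n} (hP : P.PosDef) : IsCholesky P (chol P) :=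
  Classical.epsilon_spec (exists_isCholesky hP)

theorem chol_eq {P L : Mat n} (hL : IsCholesky P L) : chol P = L :=
  epsilon_eq hL fun _ hM => hM.unique hL

/-! ### The flat chart for the Log-Cholesky metric. -/

/-- The strictly lower triangular part as a continuous linear map. -/
def strictLowerCLM (n : ℕ) : Mat n →L[ℝ] Mat n :=
  LinearMap.toContinuousLinearMap
    { toFun := strictLower
      map_add' := fun A B => by ext i j; by_cases h : j < i <;> simp [strictLower, h]
      map_smul' := fun c A => by ext i j; by_cases h : j < i <;> simp [strictLower, h] }

theorem strictLowerCLM_apply (A : Mat n) : strictLowerCLM n A = strictLower A := rfl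

/-- The diagonal part as a continuous linear map. -/
def diagPartCLM (n : ℕ) : Mat n →L[ℝ] Mat n :=
  LinearMap.toContinuousLinearMap
    { toFun := diagPart
      map_add' := fun A B => by simp [diagPart]
      map_smul' := fun c A => by
        ext i j
        by_cases h : i = j <;> simp [diagPart, h] }

theorem diagPartCLM_apply (A : Mat n) : diagPartCLM n A = diagPart A := rfl

theorem strictLower_apply (A : Mat n) (i j : Fin n) :
    strictLower A i j = if j < i then A i j else 0 := rfl

theorem diagPart_apply (A : Mat n) (i j : Fin n) :
    diagPart A i j = if i = j then A i i else 0 := diagonal_apply ..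

theorem strictLower_mem_lowerSubmodule (A : Mat n) : strictLower A ∈ lowerSubmodule n :=
  mem_lowerSubmodule.2 fun _ _ hij => if_neg hij.not_gt

theorem diagonal_mem_lowerSubmodule (d : Fin n → ℝ) : (diagonal d : Mat n) ∈ lowerSubmodule n :=
  blockTriangular_diagonal _

theorem strictLower_add_diagPart {A : Mat n} (hA : A ∈ lowerSubmodule n) :
    strictLower A + diagPart A = A := by
  ext i j
  rw [Matrix.add_apply, strictLower_apply, diagPart_apply]
  rcases lt_trichotomy i j with h | rfl | h
  · simp [h.ne, h.not_gt, mem_lowerSubmodule.1 hA i j h]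
  · simp
  · simp [h, h.ne']

/-- The matrix whose strictly upper triangular part is that of `A` and which is otherwise zero. -/
def strictUpper (A : Mat n) : Mat n := (strictLower Aᵀ)ᵀ

theorem strictUpper_apply (A : Mat n) (i j : Fin n) :
    strictUpper A i j = if i < j then A i j else 0 := rfl

/-- The skew-symmetric matrix with the same strictly upper triangular part. -/
def skewUpper (n : ℕ) : Mat n →L[ℝ] Mat n :=
  (transposeCLM n - ContinuousLinearMap.id ℝ (Mat n)) ∘L strictLowerCLM n ∘L transposeCLM n

theorem skewUpper_apply (A : Mat n) : skewUpper n A = strictUpper A - (strictUpper A)ᵀ := rfl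

theorem skewUpper_transpose (A : Mat n) : (skewUpper n A)ᵀ = -skewUpper n A := by
  rw [skewUpper_apply, transpose_sub, transpose_transpose, neg_sub]

theorem skewUpper_of_lower {A : Mat n} (hA : A ∈ lowerSubmodule n) : skewUpper n A = 0 := by
  have : strictUpper A = 0 := by
    ext i j
    rw [strictUpper_apply]
    split_ifs with h
    · exact mem_lowerSubmodule.1 hA i j h
    · rfl
  rw [skewUpper_apply, this, transpose_zero, sub_zero]

theorem strictUpper_skewUpper (A : Mat n) : strictUpper (skewUpper n A) = strictUpper A := by
  ext i j
  rw [strictUpper_apply, skewUpper_apply, Matrix.sub_apply, transpose_apply, strictUpper_apply,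
    strictUpper_apply]
  split_ifs with h1 h2 <;> simp
  exact absurd h1 h2.not_gt

/-- The lower triangular matrix with positive diagonal that is obtained from the lower triangular
part of a matrix by exponentiating the diagonal. -/
def lowerExp (T : Mat n) : Mat n := strictLower T + exp (diagPart T)

theorem exp_diagPart (T : Mat n) :
    exp (diagPart T) = diagonal fun i => Real.exp (T i i) := by
  rw [diagPart, Matrix.exp_diagonal]
  congr 1
  funext i
  rw [Pi.coe_exp, Real.exp_eq_exp_ℝ]

theorem lowerExp_mem (T : Mat n) : lowerExp T ∈ lowerSubmodule n := by
  rw [lowerExp, exp_diagPart]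
  exact (lowerSubmodule n).add_mem (strictLower_mem_lowerSubmodule T)
    (diagonal_mem_lowerSubmodule _)

theorem strictLower_lowerExp (T : Mat n) : strictLower (lowerExp T) = strictLower T := by
  ext i j
  rw [lowerExp, exp_diagPart, strictLower_apply, Matrix.add_apply, strictLower_apply]
  split_ifs with h
  · rw [diagonal_apply_ne _ h.ne', add_zero]
  · rfl

theorem lowerExp_apply_self (T : Mat n) (i : Fin n) : lowerExp T i i = Real.exp (T i i) := by
  rw [lowerExp, exp_diagPart, Matrix.add_apply, strictLower_apply, if_neg (lt_irrefl i),
    diagonal_apply_eq, zero_add]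

theorem isCholesky_lowerExp (T : Mat n) : IsCholesky (lowerExp T * (lowerExp T)ᵀ) (lowerExp T) :=
  isCholesky_iff.2 ⟨lowerExp_mem T, fun i => by
    rw [lowerExp_apply_self]; exact Real.exp_pos _, rfl⟩

theorem isUnit_det_lowerExp (T : Mat n) : IsUnit (lowerExp T).det :=
  isUnit_det_of_lower (lowerExp_mem T) (isCholesky_lowerExp T).2.1

theorem contDiff_lowerExp {m : WithTop ℕ∞} : ContDiff ℝ m (lowerExp : Mat n → Mat n) :=
  (strictLowerCLM n).contDiff.add ((contDiff_exp.of_le le_top).comp (diagPartCLM n).contDiff)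

theorem hasDerivAt_lowerExp (T Y : Mat n) :
    HasDerivAt (fun t : ℝ => lowerExp (T + t • Y))
      (strictLower Y + exp (diagPart T) * diagPart Y) 0 := by
  have h1 : HasDerivAt (fun t : ℝ => exp (diagPart T) * exp (t • diagPart Y))
      (exp (diagPart T) * (exp ((0 : ℝ) • diagPart Y) * diagPart Y)) 0 :=
    (hasDerivAt_exp_smul_const (diagPart Y) (0 : ℝ)).const_mul _
  rw [zero_smul, exp_zero, one_mul] at h1
  have h2 := (hasDerivAt_add_smul (strictLower T) (strictLower Y) 0).fun_add h1
  -- Diagonal matrices commute, so the exponential splits along the line.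
  have hc : Commute (diagPart T) (diagPart Y) := commute_diagonal _ _
  have e : (fun t : ℝ => lowerExp (T + t • Y)) = fun t : ℝ =>
      strictLower T + t • strictLower Y + exp (diagPart T) * exp (t • diagPart Y) := by
    funext t
    rw [← Matrix.exp_add_of_commute _ _ (hc.smul_right t), lowerExp, ← strictLowerCLM_apply,
      ← diagPartCLM_apply, map_add, map_add, map_smul, map_smul]
    rfl
  rw [e]
  exact h2

/-- A global chart: the Cholesky factor with the logarithm applied to its diagonal, extended to
matrices that are not symmetric. -/
def cholChart (M : Mat n) : Mat n :=
  strictLower (chol (symPart n M)) + (diagonal fun i => Real.log (chol (symPart n M) i i)) +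
    strictUpper (M - symPart n M)

/-- The inverse of `cholChart`. -/
def cholChartSymm (T : Mat n) : Mat n := lowerExp T * (lowerExp T)ᵀ + skewUpper n T

theorem symPart_cholChartSymm (T : Mat n) :
    symPart n (cholChartSymm T) = lowerExp T * (lowerExp T)ᵀ := by
  rw [cholChartSymm, map_add, symPart_of_isSymm (isSymm_mul_transpose_self _),
    symPart_of_transpose_eq_neg (skewUpper_transpose T), add_zero]

/-- The symmetric part of `cholChartSymm T` is `L Lᵀ`, which determines the lower triangle of `T` by
uniqueness of the Cholesky factor; the skew part stores the strict upper triangle. -/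
theorem cholChart_cholChartSymm (T : Mat n) : cholChart (cholChartSymm T) = T := by
  rw [cholChart, symPart_cholChartSymm, chol_eq (isCholesky_lowerExp T), cholChartSymm,
    add_sub_cancel_left, strictUpper_skewUpper, strictLower_lowerExp]
  simp only [lowerExp_apply_self, Real.log_exp]
  ext i j
  rw [Matrix.add_apply, Matrix.add_apply, strictLower_apply, strictUpper_apply, diagonal_apply]
  rcases lt_trichotomy i j with h | rfl | h
  · simp [h, h.ne, h.not_gt]
  · simp
  · simp [h, h.ne', h.not_gt]

theorem contDiff_cholChartSymm {m : WithTop ℕ∞} :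
    ContDiff ℝ m (cholChartSymm : Mat n → Mat n) :=
  (contDiff_lowerExp.mul ((transposeCLM n).contDiff.comp contDiff_lowerExp)).add
    (skewUpper n).contDiff

theorem fderiv_cholChartSymm (T Y : Mat n) :
    fderiv ℝ cholChartSymm T Y =
      (strictLower Y + exp (diagPart T) * diagPart Y) * (lowerExp T)ᵀ +
        lowerExp T * (strictLower Y + exp (diagPart T) * diagPart Y)ᵀ + skewUpper n Y := by
  have h1 := HasFDerivAt.hasDerivAt_add_smul
    (contDiff_cholChartSymm.differentiable one_ne_zero T).hasFDerivAt Y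
  have h2 := hasDerivAt_lowerExp T Y
  have h3 := HasFDerivAt.hasDerivAt_add_smul (skewUpper n).hasFDerivAt (P := T) Y
  have h4 := (h2.fun_mul (HasDerivAt.matTranspose h2)).fun_add h3
  simp only [zero_smul, add_zero] at h4
  exact h1.unique h4

/-- Writing `X = L A` gives `L (A + Aᵀ) Lᵀ = 0`, so `A` is both skew-symmetric and lower triangular.
-/
theorem eq_zero_of_mul_transpose_add {L X : Mat n} (hL : L ∈ lowerSubmodule n)
    (hu : IsUnit L.det) (hX : X ∈ lowerSubmodule n) (h : X * Lᵀ + L * Xᵀ = 0) : X = 0 := by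
  obtain ⟨A, hAl, hXA⟩ : ∃ A ∈ lowerSubmodule n, X = L * A :=
    ⟨L⁻¹ * X, mul_mem_lowerSubmodule (inv_mem_lowerSubmodule hL hu) hX,
      by rw [mul_nonsing_inv_cancel_left _ _ hu]⟩
  have h1 : L * (A + Aᵀ) * Lᵀ = 0 := by
    rw [← h, hXA, transpose_mul]
    noncomm_ring
  have hut : IsUnit Lᵀ.det := by rwa [det_transpose]
  have h2 : A + Aᵀ = 0 := by
    calc A + Aᵀ = L⁻¹ * (L * (A + Aᵀ) * Lᵀ) * Lᵀ⁻¹ := by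
          rw [mul_assoc L, nonsing_inv_mul_cancel_left _ _ hu,
            mul_nonsing_inv_cancel_right _ _ hut]
      _ = 0 := by rw [h1, mul_zero, zero_mul]
  have h3 : ∀ i j, A i j + A j i = 0 := fun i j => congrFun (congrFun h2 i) j
  have hA0 : A = 0 := by
    ext i j
    rcases lt_trichotomy i j with h | rfl | h
    · exact mem_lowerSubmodule.1 hAl i j h
    · rw [Matrix.zero_apply]
      linarith [h3 i i]
    · have h4 := h3 i j
      rwa [mem_lowerSubmodule.1 hAl j i h, add_zero] at h4
  rw [hXA, hA0, mul_zero]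

theorem strictLower_add_exp_mul_mem (T Y : Mat n) :
    strictLower Y + exp (diagPart T) * diagPart Y ∈ lowerSubmodule n := by
  rw [exp_diagPart]
  exact (lowerSubmodule n).add_mem (strictLower_mem_lowerSubmodule Y)
    (mul_mem_lowerSubmodule (diagonal_mem_lowerSubmodule _) (diagonal_mem_lowerSubmodule _))

/-- The symmetric and skew parts of the derivative vanish separately: the first kills the lower
triangle of `Y`, the second its strict upper triangle. -/
theorem eq_zero_of_fderiv_cholChartSymm_eq_zero {T Y : Mat n}
    (h : fderiv ℝ cholChartSymm T Y = 0) : Y = 0 := by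
  rw [fderiv_cholChartSymm] at h
  set X := strictLower Y + exp (diagPart T) * diagPart Y with hX
  have hs : (X * (lowerExp T)ᵀ + lowerExp T * Xᵀ).IsSymm := by
    rw [IsSymm, transpose_add, transpose_mul, transpose_mul, transpose_transpose,
      transpose_transpose, add_comm]
  have h1 := congrArg (symPart n) h
  rw [map_add, map_zero, symPart_of_isSymm hs,
    symPart_of_transpose_eq_neg (skewUpper_transpose Y), add_zero] at h1
  have hX0 := eq_zero_of_mul_transpose_add (lowerExp_mem T) (isUnit_det_lowerExp T)
    (strictLower_add_exp_mul_mem T Y) h1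
  rw [h1, zero_add] at h
  have hu : strictUpper Y = 0 := by
    rw [← strictUpper_skewUpper, h]
    ext i j
    simp [strictUpper_apply]
  rw [exp_diagPart, diagPart, diagonal_mul_diagonal] at hX0
  ext i j
  have h2 := congrFun (congrFun hX0 i) j
  rw [Matrix.add_apply, strictLower_apply, diagonal_apply] at h2
  rcases lt_trichotomy i j with h | rfl | h
  · have h3 := congrFun (congrFun hu i) j
    rwa [strictUpper_apply, if_pos h] at h3
  · simpa [(Real.exp_pos _).ne'] using h2
  · simpa [h, h.ne'] using h2

theorem cholChart_of_isSymm {P : Mat n} (hP : P.IsSymm) :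
    cholChart P = strictLower (chol P) + diagonal fun i => Real.log (chol P i i) := by
  have : strictUpper (0 : Mat n) = 0 := by
    ext i j
    simp [strictUpper_apply]
  rw [cholChart, symPart_of_isSymm hP, sub_self, this, add_zero]

theorem cholChart_mem {P : Mat n} (hP : P.IsSymm) : cholChart P ∈ lowerSubmodule n := by
  rw [cholChart_of_isSymm hP]
  exact (lowerSubmodule n).add_mem (strictLower_mem_lowerSubmodule _)
    (diagonal_mem_lowerSubmodule _)

theorem diagPart_cholChart {P : Mat n} (hP : P.IsSymm) :
    diagPart (cholChart P) = diagonal fun i => Real.log (chol P i i) := by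
  rw [cholChart_of_isSymm hP, diagPart]
  congr 1
  funext i
  rw [Matrix.add_apply, strictLower_apply, if_neg (lt_irrefl i), zero_add, diagonal_apply_eq]

theorem exp_diagPart_cholChart {P : Mat n} (hP : P.PosDef) :
    exp (diagPart (cholChart P)) = diagPart (chol P) := by
  rw [exp_diagPart, diagPart]
  congr 1
  funext i
  have h := congrFun (congrFun (diagPart_cholChart (isSymm_of_posDef hP)) i) i
  rw [diagPart_apply, if_pos rfl, diagonal_apply_eq] at h
  rw [h, Real.exp_log ((isCholesky_chol hP).2.1 i)]

theorem lowerExp_cholChart {P : Mat n} (hP : P.PosDef) : lowerExp (cholChart P) = chol P := by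
  rw [lowerExp, exp_diagPart_cholChart hP]
  have : strictLower (cholChart P) = strictLower (chol P) := by
    rw [cholChart_of_isSymm (isSymm_of_posDef hP)]
    ext i j
    rw [strictLower_apply, strictLower_apply, Matrix.add_apply, strictLower_apply]
    split_ifs with h
    · rw [diagonal_apply_ne _ h.ne', add_zero]
    · rfl
  rw [this, strictLower_add_diagPart (isCholesky_iff.1 (isCholesky_chol hP)).1]

theorem cholChartSymm_of_lower {T : Mat n} (hT : T ∈ lowerSubmodule n) :
    cholChartSymm T = lowerExp T * (lowerExp T)ᵀ := by
  rw [cholChartSymm, skewUpper_of_lower hT, add_zero]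

theorem cholChartSymm_cholChart {P : Mat n} (hP : P.PosDef) : cholChartSymm (cholChart P) = P := by
  rw [cholChartSymm_of_lower (cholChart_mem (isSymm_of_posDef hP)), lowerExp_cholChart hP,
    (isCholesky_chol hP).2.2]

theorem contDiffAt_cholChart {P : Mat n} (hP : P.PosDef) : ContDiffAt ℝ 2 cholChart P := by
  have h := contDiffAt_of_leftInverse (two_ne_zero (α := WithTop ℕ∞)) contDiff_cholChartSymm
    cholChart_cholChartSymm (a := cholChart P) fun _ => eq_zero_of_fderiv_cholChartSymm_eq_zero
  rwa [cholChartSymm_cholChart hP] at h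

theorem fderiv_cholChart_fderiv {P : Mat n} (hP : P.PosDef) (Y : Mat n) :
    fderiv ℝ cholChart P (fderiv ℝ cholChartSymm (cholChart P) Y) = Y := by
  have h1 := HasFDerivAt.hasDerivAt_add_smul
    (contDiff_cholChartSymm.differentiable one_ne_zero (cholChart P)).hasFDerivAt Y
  have h2 : HasFDerivAt cholChart (fderiv ℝ cholChart P)
      (cholChartSymm (cholChart P + (0 : ℝ) • Y)) := by
    rw [zero_smul, add_zero, cholChartSymm_cholChart hP]
    exact ((contDiffAt_cholChart hP).differentiableAt two_ne_zero).hasFDerivAt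
  have h3 := HasFDerivAt.comp_hasDerivAt (0 : ℝ) h2 h1
  have e : (cholChart ∘ fun t : ℝ => cholChartSymm (cholChart P + t • Y)) =
      fun t : ℝ => cholChart P + t • Y := funext fun t => cholChart_cholChartSymm _
  rw [e] at h3
  exact h3.unique (hasDerivAt_add_smul (cholChart P) Y 0)

theorem lowerHalf_mem (S : Mat n) : lowerHalf S ∈ lowerSubmodule n :=
  (lowerSubmodule n).add_mem (strictLower_mem_lowerSubmodule S)
    ((lowerSubmodule n).smul_mem _ (diagonal_mem_lowerSubmodule _))

theorem lowerHalf_add_transpose {S : Mat n} (hS : S.IsSymm) :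
    lowerHalf S + (lowerHalf S)ᵀ = S := by
  ext i j
  rw [Matrix.add_apply, transpose_apply]
  simp only [lowerHalf, Matrix.add_apply, Matrix.smul_apply, strictLower_apply, diagPart_apply, smul_eq_mul]
  rcases lt_trichotomy i j with h | rfl | h
  · simp [h, h.ne, h.ne', h.not_gt, hS.apply]
  · simp
    ring
  · simp [h, h.ne, h.ne', h.not_gt]

/-- This confirms that `dChol L` solves the linearisation `X Lᵀ + L Xᵀ = W` of `L Lᵀ = P`. -/
theorem dChol_mul_transpose_add {L W : Mat n} (hu : IsUnit L.det) (hW : W.IsSymm) :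
    dChol L W * Lᵀ + L * (dChol L W)ᵀ = W := by
  have hS : (L⁻¹ * W * (L⁻¹)ᵀ).IsSymm := by
    rw [IsSymm, transpose_mul, transpose_mul, transpose_transpose, hW.eq, mul_assoc]
  have hut : (L⁻¹)ᵀ * Lᵀ = 1 := by
    rw [← transpose_mul, Matrix.mul_nonsing_inv _ hu, transpose_one]
  calc _ = L * (lowerHalf (L⁻¹ * W * (L⁻¹)ᵀ) + (lowerHalf (L⁻¹ * W * (L⁻¹)ᵀ))ᵀ) * Lᵀ := by
        rw [dChol, transpose_mul]
        noncomm_ring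
    _ = (L * L⁻¹) * W * ((L⁻¹)ᵀ * Lᵀ) := by
        rw [lowerHalf_add_transpose hS]
        noncomm_ring
    _ = W := by rw [hut, Matrix.mul_nonsing_inv _ hu, one_mul, mul_one]

theorem diagPart_inv {L : Mat n} (hL : ∀ i, 0 < L i i) :
    (diagPart L)⁻¹ = diagonal fun i => (L i i)⁻¹ := by
  refine Matrix.inv_eq_right_inv ?_
  rw [diagPart, diagonal_mul_diagonal, ← diagonal_one]
  congr 1
  funext i
  exact mul_inv_cancel₀ (hL i).ne'

/-- The derivative is verified rather than computed: the candidate `Y` is sent to `W` by the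
derivative of the inverse chart, which `fderiv_cholChart_fderiv` then undoes. -/
theorem fderiv_cholChart {P W : Mat n} (hP : P.PosDef) (hW : W.IsSymm) :
    fderiv ℝ cholChart P W = strictLower (dChol (chol P) W) +
      (diagPart (chol P))⁻¹ * diagPart (dChol (chol P) W) := by
  obtain ⟨hL, hd, -⟩ := isCholesky_iff.1 (isCholesky_chol hP)
  have hu := isUnit_det_of_lower hL hd
  set L := chol P with hLdef
  set X := dChol L W with hX
  set Y := strictLower X + (diagPart L)⁻¹ * diagPart X with hY
  have hXl : X ∈ lowerSubmodule n := mul_mem_lowerSubmodule hL (lowerHalf_mem _)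
  have hYd : Y = strictLower X + diagonal fun i => (L i i)⁻¹ * X i i := by
    rw [hY, diagPart_inv hd, diagPart, diagonal_mul_diagonal]
  have hYl : Y ∈ lowerSubmodule n := by
    rw [hYd]
    exact (lowerSubmodule n).add_mem (strictLower_mem_lowerSubmodule _)
      (diagonal_mem_lowerSubmodule _)
  have h1 : strictLower Y = strictLower X := by
    rw [hYd]
    ext i j
    rw [strictLower_apply, strictLower_apply, Matrix.add_apply, strictLower_apply]
    split_ifs with h
    · rw [diagonal_apply_ne _ h.ne', add_zero]
    · rfl
  have h2 : diagPart L * diagPart Y = diagPart X := by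
    rw [diagPart, diagPart, diagonal_mul_diagonal, diagPart]
    congr 1
    funext i
    rw [hYd, Matrix.add_apply, strictLower_apply, if_neg (lt_irrefl i), zero_add, diagonal_apply_eq,
      mul_inv_cancel_left₀ (hd i).ne']
  have h3 : fderiv ℝ cholChartSymm (cholChart P) Y = W := by
    rw [fderiv_cholChartSymm, exp_diagPart_cholChart hP, lowerExp_cholChart hP, ← hLdef, h1, h2,
      skewUpper_of_lower hYl, strictLower_add_diagPart hXl, add_zero,
      dChol_mul_transpose_add hu hW]
  rw [← h3, fderiv_cholChart_fderiv hP]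

theorem frob_strictLower_diagonal (A : Mat n) (d : Fin n → ℝ) :
    frob (strictLower A) (diagonal d) = 0 := by
  rw [frob, trace]
  refine Finset.sum_eq_zero fun i _ => ?_
  rw [diag_apply, mul_diagonal, transpose_apply, strictLower_apply, if_neg (lt_irrefl i), zero_mul]

/-- Strictly lower triangular and diagonal matrices are Frobenius-orthogonal, so the two terms of
the Log-Cholesky metric form a single Frobenius product in the chart. -/
theorem frob_strictLower_add_diagonal (A B : Mat n) (d e : Fin n → ℝ) :
    frob (strictLower A + diagonal d) (strictLower B + diagonal e) =
      frob (strictLower A) (strictLower B) + frob (diagonal d) (diagonal e) := by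
  rw [frob_add_left, frob_comm (strictLower A), frob_comm (diagonal d), frob_add_left,
    frob_add_left, frob_strictLower_diagonal, frob_comm (diagonal e) (strictLower A),
    frob_strictLower_diagonal, frob_comm (strictLower B), frob_comm (diagonal e)]
  ring

theorem isFlatChart_metricLC (n : ℕ) :
    IsFlatChart (metricLC n) cholChart cholChartSymm (lowerSubmodule n) where
  contDiff_symm := contDiff_cholChartSymm
  contDiffAt _ hP := contDiffAt_cholChart hP
  mem _ hP := cholChart_mem (isSymm_of_posDef hP)
  posDef T hT := by
    rw [cholChartSymm_of_lower hT]
    have := posDef_mul_mul_transpose PosDef.one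
      ((isUnit_iff_isUnit_det _).2 (isUnit_det_lowerExp T))
    rwa [mul_one] at this
  right_inv T _ := cholChart_cholChartSymm T
  left_inv _ hP := cholChartSymm_cholChart hP
  metric_eq P W V hP hW hV := by
    rw [fderiv_cholChart hP hW, fderiv_cholChart hP hV, metricLC, metricCholesky,
      diagPart_inv (isCholesky_chol hP).2.1, diagPart, diagPart, diagonal_mul_diagonal,
      diagonal_mul_diagonal, frob_strictLower_add_diagonal]
  map_one := by
    have h : IsCholesky (1 : Mat n) 1 :=
      ⟨fun i j hij => one_apply_ne hij.ne, fun i => by simp, by simp⟩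
    rw [cholChart_of_isSymm isSymm_one, chol_eq h]
    ext i j
    rw [Matrix.add_apply, strictLower_apply, diagonal_apply, one_apply_eq, Real.log_one, ite_self,
      add_zero, Matrix.zero_apply]
    split_ifs with hij
    · exact one_apply_ne hij.ne'
    · rfl

end SPDGyro

end

theorem mainTheorem11 (k : SPDGyro.Geometry) (n : ℕ) :
    (∀ P : SPDGyro.SPD n, ∃! R : SPDGyro.SPD n,
      SPDGyro.gyroAdd (k.metric n) R P = SPDGyro.SPD.id n) ∧
    SPDGyro.IsGyroisometry (k.metric n) (SPDGyro.gyroNeg (k.metric n)) := by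
  cases k with
  | le => exact ⟨(SPDGyro.isFlatChart_metricLE n).existsUnique_gyroAdd_eq_id,
      (SPDGyro.isFlatChart_metricLE n).isGyroisometry_gyroNeg⟩
  | lc => exact ⟨(SPDGyro.isFlatChart_metricLC n).existsUnique_gyroAdd_eq_id,
      (SPDGyro.isFlatChart_metricLC n).isGyroisometry_gyroNeg⟩
  | ai => exact ⟨SPDGyro.existsUnique_gyroAdd_metricAI_eq_id,
      SPDGyro.isGyroisometry_gyroNeg_metricAI⟩
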